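/- All bodies are centrally symmetric. A convex body in $\mathbb{R}^n$ is a compact convex set $K=-K$ with non-empty interior; it is in isotropic position if $\int_K\langle x,\theta\rangle^2\,dx$ is the same for all unit vectors $\theta$. Its isotropic constant $L_K\ge 0$ is defined by $L_K^2=\int_{T(K)}\langle x,\theta\rangle^2\,dx$ for all unit vectors $\theta$, where $T$ is an invertible linear map such that $T(K)$ has volume $1$ and is in isotropic position ($L_K$ does not depend on the choice of $T$). Let $\mathcal{L}_k$ denote the supremum of the isotropic constants of centrally symmetric convex bodies in $\mathbb{R}^k$. A star body is a compact set $L=-L\subset\mathbb{R}^n$ with non-empty interior such that $tL\subset L$ for $t\in[0,1]$ and whose radial function $\rho_L(\theta)=\max\{r\ge 0: r\theta\in L\}$ is continuous on $S^{n-1}$. For $p\in\mathbb{R}$ put $$\widetilde V_p(L_1,L_2)=\frac1n\int_{S^{n-1}}\rho_{L_1}(x)^p\,\rho_{L_2}(x)^{n-p}\,dx ,$$ the integral being with respect to the surface measure on $S^{n-1}$. For $1\le k\le n-1$, the class $BP_k^n$ of $k$-Busemann--Petty bodies consists of the star bodies $L$ in $\mathbb{R}^n$ for which there is a non-negative finite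 Borel measure $\mu$ on the Grassmannian $G(n,n-k)$ of $(n-k)$-dimensional linear subspaces with $$\int_{S^{n-1}} f\,\rho_L^k\,d\sigma=\int_{G(n,n-k)}\Big(\int_{S^{n-1}\cap E} f\,d\sigma_E\Big)d\mu(E)\qquad\text{for all } f\in C(S^{n-1}),$$ where $\sigma$ and $\sigma_E$ are the rotation invariant probability measures on $S^{n-1}$ and $S^{n-1}\cap E$. **Theorem.** There are universal constants $C_1,C_2>0$ such that the following holds for all integers $n,k$ with $1\le k\le n-1$. Let $K$ be a centrally symmetric convex body in $\mathbb{R}^n$ in isotropic position, let $D$ be the Euclidean ball centred at the origin with $\mathrm{Vol}(D)=\mathrm{Vol}(K)$, and let $L\in BP_k^n$. Then $$C_1\;\le\; L_K\Big/\left(\frac{\widetilde V_k(L,D)}{\widetilde V_k(L,K)}\right)^{1/k}\;\le\; C_2\,\mathcal{L}_k .$$ -/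

import Mathlib

open MeasureTheory Metric Set

noncomputable section

/-- A centrally symmetric convex body in `ℝⁿ`: compact, convex, with non-empty interior. -/
structure IsSymmConvexBody {n : ℕ} (K : Set (EuclideanSpace ℝ (Fin n))) : Prop where
  isCompact : IsCompact K
  convex : Convex ℝ K
  interior_nonempty : (interior K).Nonempty
  neg_mem : ∀ x ∈ K, -x ∈ K

/-- `K` is in isotropic position: `∫_K ⟨x, θ⟩² dx` does not depend on the unit vector `θ`. -/
def IsInIsotropicPosition {n : ℕ} (K : Set (EuclideanSpace ℝ (Fin n))) : Prop :=
  ∃ c : ℝ, ∀ θ : EuclideanSpace ℝ (Fin n), ‖θ‖ = 1 → ∫ x in K, (inner ℝ x θ) ^ 2 = c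

/-- The isotropic constant `L_K`: the number `c ≥ 0` such that `∫_{T(K)} ⟨x, θ⟩² dx = c²` for all
unit vectors `θ`, where `T(K)` is a linear image of `K` of volume one in isotropic position.
The isotropic image of volume one of a centrally symmetric convex body exists and is unique up to
orthogonal maps, so the set below has exactly one element and `sSup` picks it. -/
def isotropicConstant {n : ℕ} (K : Set (EuclideanSpace ℝ (Fin n))) : ℝ :=
  sSup {c : ℝ | 0 ≤ c ∧
    ∃ T : EuclideanSpace ℝ (Fin n) ≃ₗ[ℝ] EuclideanSpace ℝ (Fin n),
      volume (T '' K) = 1 ∧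
      ∀ θ : EuclideanSpace ℝ (Fin n), ‖θ‖ = 1 → ∫ x in T '' K, (inner ℝ x θ) ^ 2 = c ^ 2}

/-- `𝓛_k`: the maximal isotropic constant of centrally symmetric convex bodies in `ℝᵏ`
(these constants are bounded for fixed `k`, so this is a genuine real supremum). -/
def maxIsotropicConstant (k : ℕ) : ℝ :=
  sSup {c : ℝ | ∃ K : Set (EuclideanSpace ℝ (Fin k)),
    IsSymmConvexBody K ∧ c = isotropicConstant K}

/-- The radial function `ρ_L(θ) = max {r ≥ 0 | r θ ∈ L}`. -/
def radialFunction {n : ℕ} (L : Set (EuclideanSpace ℝ (Fin n)))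
    (θ : EuclideanSpace ℝ (Fin n)) : ℝ :=
  sSup {r : ℝ | 0 ≤ r ∧ r • θ ∈ L}

/-- A centrally symmetric star body: star-shaped about the origin, compact, with non-empty interior,
and with a continuous radial function on the unit sphere. It need not be convex. -/
structure IsStarBody {n : ℕ} (L : Set (EuclideanSpace ℝ (Fin n))) : Prop where
  isCompact : IsCompact L
  interior_nonempty : (interior L).Nonempty
  neg_mem : ∀ x ∈ L, -x ∈ L
  smul_mem : ∀ x ∈ L, ∀ t : ℝ, 0 ≤ t → t ≤ 1 → t • x ∈ L
  continuousOn_radial : ContinuousOn (radialFunction L) (sphere 0 1)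

/-- The dual mixed volume
`Ṽ_p(L₁, L₂) = (1/n) ∫_{S^{n-1}} ρ_{L₁}(x)^p ρ_{L₂}(x)^{n-p} dx` of order `p ∈ ℝ`, with respect to
the Lebesgue (surface) measure on the sphere. -/
def dualMixedVolume {n : ℕ} (p : ℝ) (L₁ L₂ : Set (EuclideanSpace ℝ (Fin n))) : ℝ :=
  (1 / (n : ℝ)) *
    ∫ x : sphere (0 : EuclideanSpace ℝ (Fin n)) 1,
      radialFunction L₁ x ^ p * radialFunction L₂ x ^ ((n : ℝ) - p)
      ∂((volume : Measure (EuclideanSpace ℝ (Fin n))).toSphere)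

/-- The rotation invariant probability measure on the unit sphere of a Euclidean space `F`
(of positive dimension): normalized surface measure. -/
def sphereProb (F : Type*) [NormedAddCommGroup F] [InnerProductSpace ℝ F] [FiniteDimensional ℝ F]
    [MeasurableSpace F] [BorelSpace F] : Measure (sphere (0 : F) 1) :=
  ((volume : Measure F).toSphere univ)⁻¹ • (volume : Measure F).toSphere

/-- The Grassmannian `G(n, m)` of `m`-dimensional linear subspaces of `ℝⁿ`. -/
def RealGrassmannian (n m : ℕ) : Type :=
  {E : Submodule ℝ (EuclideanSpace ℝ (Fin n)) // Module.finrank ℝ E = m}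

/-- The span of an orthonormal `m`-frame in `ℝⁿ`. -/
def frameSpan {n m : ℕ} (v : {v : Fin m → EuclideanSpace ℝ (Fin n) // Orthonormal ℝ v}) :
    RealGrassmannian n m :=
  ⟨Submodule.span ℝ (range v.1), by
    rw [finrank_span_eq_card v.2.linearIndependent, Fintype.card_fin]⟩

/-- The usual topology of the Grassmannian: the quotient topology from the Stiefel manifold of
orthonormal `m`-frames. -/
instance {n m : ℕ} : TopologicalSpace (RealGrassmannian n m) :=
  TopologicalSpace.coinduced frameSpan inferInstance

instance {n m : ℕ} : MeasurableSpace (RealGrassmannian n m) := borel _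

instance {n m : ℕ} : BorelSpace (RealGrassmannian n m) := ⟨rfl⟩

/-- The inclusion of the unit sphere of a subspace `E` in the unit sphere of `ℝⁿ`. -/
def sphereInclusion {n : ℕ} (E : Submodule ℝ (EuclideanSpace ℝ (Fin n)))
    (θ : sphere (0 : E) 1) : sphere (0 : EuclideanSpace ℝ (Fin n)) 1 :=
  ⟨((θ : E) : EuclideanSpace ℝ (Fin n)), mem_sphere_zero_iff_norm.2 (mem_sphere_zero_iff_norm.1 θ.2)⟩

/-- The `m`-dimensional spherical Radon transform `R_m f (E) = ∫_{S^{n-1} ∩ E} f dσ_m`. -/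
def sphericalRadon {n m : ℕ} (f : C(sphere (0 : EuclideanSpace ℝ (Fin n)) 1, ℝ))
    (E : RealGrassmannian n m) : ℝ :=
  ∫ θ : sphere (0 : E.1) 1, f (sphereInclusion E.1 θ) ∂(sphereProb E.1)

/-- The class `BP_k^n` of `k`-Busemann-Petty bodies (for `1 ≤ k < n`): star bodies `L` with
`ρ_L^k = R_{n-k}^*(dμ)` for some non-negative finite Borel measure `μ` on `G(n, n-k)`. Here
`R_{n-k}^*` is the dual of `R_{n-k}`, and the function `ρ_L^k` is identified with the measure that
has density `ρ_L^k` with respect to the invariant probability measure on the sphere. -/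
def IsBusemannPettyBody {n : ℕ} (k : ℕ) (L : Set (EuclideanSpace ℝ (Fin n))) : Prop :=
  IsStarBody L ∧
    ∃ μ : Measure (RealGrassmannian n (n - k)), IsFiniteMeasure μ ∧
      ∀ f : C(sphere (0 : EuclideanSpace ℝ (Fin n)) 1, ℝ),
        ∫ θ : sphere (0 : EuclideanSpace ℝ (Fin n)) 1, f θ * radialFunction L θ ^ k
          ∂(sphereProb (EuclideanSpace ℝ (Fin n))) =
        ∫ E : RealGrassmannian n (n - k), sphericalRadon f E ∂μ

end

/-! Put `m = n - k`, let `r` be the radius of `D` and `ω_d` the volume of the unit ball in dimension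
`d`. Testing the identity that defines `BP_k^n` against `ρ_K ^ m` and against the constant `r ^ m`
turns the ratio of dual mixed volumes into `r ^ m * μ(G)` divided by the `μ`-integral of `E ↦ vol(K
∩ E) / ω_m` (`IsBusemannPettyBody.dualMixedVolume_div`). It is therefore enough to bound `L_K ^ k *
vol(K ∩ E) / ω_m`, for every single `E`, between `c ^ k * r ^ m` and `(C * 𝓛_k) ^ k * r ^ m`
(`sphericalRadon_bounds`), to integrate against `μ`, and to take `k`-th roots.

Fix `E` and let `g y` be the volume of `K ∩ (E + y)` for `y` in the orthogonal complement, a copy of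
`ℝᵏ`. By Brunn's theorem `g` is even and log-concave, so its maximum is `g 0`. By Fubini it has mass
`V = vol K` and the same second moment `A` as `K` in every direction, where `A = L_K ^ 2 * V ^ (1 +
2 / n)`.

Lower bound on `g 0` (`IsEvenLogConcave.volume_le`): by Chebyshev, half of the mass sits in the ball
of radius `√(2 k A / V)`, where `g ≤ g 0`.

Upper bound on `g 0` (`IsEvenLogConcave.le_maxIsotropicConstant`): Ball's set of all `y` with `∫ r ^
(k + 1) g(r y) dr ≥ g 0 / (k + 2)` is convex by Ball's inequality, its second moments are exactly `A
/ g 0`, and its volume is at most `54 V / g 0` by a reverse Hölder inequality for log-concave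
functions. Since its isotropic constant is at most `𝓛_k`, this bounds `A * g 0 ^ (2 / k)`.

Both bounds are then compared with `r ^ m = (V / ω_n) ^ (m / n)`; here `ω_m` and `ω_n ^ (m / n)`
differ by a factor of at most `√6 ^ k`, which a `k`-th root reduces to a constant. -/

/-! ### The Prékopa–Leindler inequality and Brunn's theorem. -/

open scoped Pointwise in
theorem volume_add_volume_le_of_compact {A B C : Set ℝ} (hA : IsCompact A) (hB : IsCompact B)
    (hA0 : A.Nonempty) (hB0 : B.Nonempty) {a b : ℝ} (ha : 0 < a) (hb : 0 < b)
    (h : ∀ x ∈ A, ∀ y ∈ B, a * x + b * y ∈ C) :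
    ENNReal.ofReal a * volume A + ENNReal.ofReal b * volume B ≤ volume C := by
  -- The copies `a A + b q` and `a p + b B`, with `p = max A` and `q = min B`, both lie in `C` and
  -- meet only at the point `a p + b q`, so their lengths add up.
  obtain ⟨p, hpA, hp⟩ := hA.exists_isGreatest hA0
  obtain ⟨q, hqB, hq⟩ := hB.exists_isLeast hB0
  rw [← measure_inter_add_sdiff C (measurableSet_Iic (a := a * p + b * q))]
  have hs : ∀ (c d : ℝ) (S : Set ℝ), 0 < c →
      volume ((fun x => c * x + d) '' S) = ENNReal.ofReal c * volume S := by
    intro c d S hc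
    have : (fun x => c * x + d) '' S = (fun x => x + d) '' (c • S) := by
      ext x; simp [Set.mem_smul_set, ← sub_eq_add_neg, eq_sub_iff_add_eq]
    rw [this, image_add_right, measure_preimage_add_right, Measure.addHaar_smul]
    simp [abs_of_pos hc]
  gcongr
  · rw [← hs a (b * q) A ha]
    apply measure_mono
    rintro _ ⟨x, hx, rfl⟩
    refine ⟨h x hx q hqB, ?_⟩
    have := hp hx
    simp only [mem_Iic]
    gcongr
  · rw [← hs b (a * p) B hb, ← measure_sdiff_null (s := (fun x => b * x + a * p) '' B)
      (measure_singleton (a * p + b * q))]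
    apply measure_mono
    rintro _ ⟨⟨y, hy, rfl⟩, hne⟩
    refine ⟨by simpa [add_comm] using h p hpA y hy, ?_⟩
    have h1 : q ≤ y := hq hy
    simp only [mem_Iic, not_le, mem_singleton_iff] at hne ⊢
    have h2 : b * q ≤ b * y := by gcongr
    exact lt_of_le_of_ne (by linarith) (fun e => hne (by simp only [← e]))

theorem volume_add_volume_le {A B C : Set ℝ} (hA : MeasurableSet A) (hB : MeasurableSet B)
    (hA0 : A.Nonempty) (hB0 : B.Nonempty) {a b : ℝ} (ha : 0 < a) (hb : 0 < b)
    (h : ∀ x ∈ A, ∀ y ∈ B, a * x + b * y ∈ C) :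
    ENNReal.ofReal a * volume A + ENNReal.ofReal b * volume B ≤ volume C := by
  obtain ⟨x₀, hx₀⟩ := hA0
  obtain ⟨y₀, hy₀⟩ := hB0
  rw [hA.measure_eq_iSup_isCompact, hB.measure_eq_iSup_isCompact]
  simp only [ENNReal.mul_iSup, iSup_and']
  have e : ∀ S : Set ℝ, Nonempty {K : Set ℝ // K ⊆ S ∧ IsCompact K} :=
    fun S => ⟨∅, by simp⟩
  refine ENNReal.biSup_add_biSup_le' ⟨∅, by simp⟩ ⟨∅, by simp⟩ fun K hK K' hK' => ?_
  -- Adjoining a point keeps the approximating compact sets non-empty.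
  calc _ ≤ ENNReal.ofReal a * volume (insert x₀ K) + ENNReal.ofReal b * volume (insert y₀ K') := by
        gcongr <;> exact subset_insert _ _
    _ ≤ _ := volume_add_volume_le_of_compact (hK.2.insert _) (hK'.2.insert _)
        (insert_nonempty _ _) (insert_nonempty _ _) ha hb fun x hx y hy =>
          h x (insert_subset hx₀ hK.1 hx) y (insert_subset hy₀ hK'.1 hy)

theorem ENNReal.rpow_mul_rpow_le_add {a b : ℝ} (ha : 0 < a) (hb : 0 < b) (hab : a + b = 1)
    (x y : ENNReal) : x ^ a * y ^ b ≤ ENNReal.ofReal a * x + ENNReal.ofReal b * y := by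
  have h := ENNReal.young_inequality (x ^ a) (y ^ b) (p := 1 / a) (q := 1 / b)
    ⟨by simp [hab], by positivity, by positivity⟩
  rw [← ENNReal.rpow_mul, ← ENNReal.rpow_mul, mul_one_div_cancel ha.ne', mul_one_div_cancel hb.ne',
    ENNReal.rpow_one, ENNReal.rpow_one, ENNReal.div_eq_inv_mul, ENNReal.div_eq_inv_mul,
    ← ENNReal.ofReal_inv_of_pos (by positivity), ← ENNReal.ofReal_inv_of_pos (by positivity)] at h
  simpa using h

/-- Additive form for functions with the same supremum. -/
theorem lintegral_add_le_of_level {f g h : ℝ → ℝ} (hf : Measurable f) (hg : Measurable g)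
    (hh : Measurable h) (hf0 : ∀ x, 0 ≤ f x) (hg0 : ∀ x, 0 ≤ g x)
    (hf1 : IsLUB (range f) 1) (hg1 : IsLUB (range g) 1) {a b : ℝ} (ha : 0 < a) (hb : 0 < b)
    (hab : a + b = 1) (H : ∀ x y, f x ^ a * g y ^ b ≤ h (a * x + b * y)) (hh0 : ∀ x, 0 ≤ h x) :
    ENNReal.ofReal a * (∫⁻ x, ENNReal.ofReal (f x)) +
      ENNReal.ofReal b * (∫⁻ x, ENNReal.ofReal (g x)) ≤ ∫⁻ x, ENNReal.ofReal (h x) := by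
  rw [lintegral_eq_lintegral_meas_lt _ (ae_of_all _ hf0) hf.aemeasurable,
    lintegral_eq_lintegral_meas_lt _ (ae_of_all _ hg0) hg.aemeasurable,
    lintegral_eq_lintegral_meas_lt _ (ae_of_all _ hh0) hh.aemeasurable]
  have hm : ∀ u : ℝ → ℝ, Measurable fun t : ℝ => volume {x | t < u x} := fun u =>
    Antitone.measurable fun s t hst => measure_mono fun x hx => lt_of_le_of_lt hst hx
  rw [← lintegral_const_mul _ (hm f), ← lintegral_const_mul _ (hm g),
    ← lintegral_add_left ((hm f).const_mul _)]
  refine setLIntegral_mono (hm h) fun t ht => ?_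
  -- Below level 1 both superlevel sets are non-empty, which is where the common supremum matters,
  -- and `t ^ a * t ^ b = t` puts their combination inside the superlevel set of `h`. From level 1
  -- on, those of `f` and `g` are empty.
  rcases lt_or_ge t 1 with ht1 | ht1
  · refine volume_add_volume_le (measurableSet_lt measurable_const hf)
      (measurableSet_lt measurable_const hg) ?_ ?_ ha hb fun x hx y hy => ?_
    · obtain ⟨_, ⟨x, rfl⟩, hx⟩ := (lt_isLUB_iff hf1).1 ht1
      exact ⟨x, hx⟩
    · obtain ⟨_, ⟨x, rfl⟩, hx⟩ := (lt_isLUB_iff hg1).1 ht1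
      exact ⟨x, hx⟩
    · simp only [mem_ofPred_eq] at hx hy ⊢
      refine lt_of_lt_of_le ?_ (H x y)
      have ht0 : (0 : ℝ) < t := ht
      calc t = t ^ a * t ^ b := by rw [← Real.rpow_add ht0, hab, Real.rpow_one]
        _ < _ := by gcongr
  · have e1 : {x | t < f x} = ∅ := by
      ext x; simpa using (hf1.1 ⟨x, rfl⟩).trans ht1
    have e2 : {x | t < g x} = ∅ := by
      ext x; simpa using (hg1.1 ⟨x, rfl⟩).trans ht1
    simp [e1, e2]

/-- Scaling `f` and `g` to supremum 1, and `h` by the matching factor `M ^ a * N ^ b`, gives the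
stronger additive inequality; the weighted arithmetic-geometric mean inequality turns it into the
product form. -/
theorem prekopa_leindler_of_bounded {f g h : ℝ → ℝ} (hf : Measurable f) (hg : Measurable g)
    (hh : Measurable h) (hf0 : ∀ x, 0 ≤ f x) (hg0 : ∀ x, 0 ≤ g x) (hh0 : ∀ x, 0 ≤ h x)
    (hfb : BddAbove (range f)) (hgb : BddAbove (range g)) {a b : ℝ} (ha : 0 < a) (hb : 0 < b)
    (hab : a + b = 1) (H : ∀ x y, f x ^ a * g y ^ b ≤ h (a * x + b * y)) :
    (∫⁻ x, ENNReal.ofReal (f x)) ^ a * (∫⁻ x, ENNReal.ofReal (g x)) ^ b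
      ≤ ∫⁻ x, ENNReal.ofReal (h x) := by
  have key : ∀ u : ℝ → ℝ, (∀ x, 0 ≤ u x) → BddAbove (range u) →
      (∀ x, u x = 0) ∨ ∃ M, 0 < M ∧ IsLUB (range fun x => M⁻¹ * u x) 1 := by
    intro u hu hb
    by_cases h0 : ∀ x, u x = 0
    · exact Or.inl h0
    · push Not at h0
      obtain ⟨x, hx⟩ := h0
      have hl := isLUB_csSup (range_nonempty u) hb
      have hM : 0 < sSup (range u) := lt_of_lt_of_le (lt_of_le_of_ne (hu x) hx.symm) (hl.1 ⟨x, rfl⟩)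
      refine Or.inr ⟨_, hM, ?_, fun c hc => ?_⟩
      · rintro _ ⟨y, rfl⟩
        rw [inv_mul_le_iff₀ hM, mul_one]
        exact hl.1 ⟨y, rfl⟩
      · have : sSup (range u) ≤ sSup (range u) * c := by
          refine hl.2 ?_
          rintro _ ⟨y, rfl⟩
          rw [← inv_mul_le_iff₀ hM]
          exact hc ⟨y, rfl⟩
        exact le_of_mul_le_mul_left (by simpa using this) hM
  rcases key f hf0 hfb with h0 | ⟨M, hM, hfM⟩
  · simp [h0, ha]
  rcases key g hg0 hgb with h0 | ⟨N, hN, hgN⟩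
  · simp [h0, hb]
  have hc : 0 < M ^ a * N ^ b := by positivity
  have := lintegral_add_le_of_level (hf.const_mul M⁻¹) (hg.const_mul N⁻¹)
    (hh.const_mul (M ^ a * N ^ b)⁻¹) (fun x => mul_nonneg (by positivity) (hf0 x))
    (fun x => mul_nonneg (by positivity) (hg0 x)) hfM hgN ha hb hab
    (fun x y => by
      rw [Real.mul_rpow (by positivity) (hf0 x), Real.mul_rpow (by positivity) (hg0 y),
        Real.inv_rpow hM.le, Real.inv_rpow hN.le, mul_inv, mul_mul_mul_comm]
      gcongr
      exact H x y) (fun x => mul_nonneg (by positivity) (hh0 x))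
  have e : ∀ (u : ℝ → ℝ) (c : ℝ), Measurable u → 0 < c → ∫⁻ x, ENNReal.ofReal (u x) =
      ENNReal.ofReal c * ∫⁻ x, ENNReal.ofReal (c⁻¹ * u x) := by
    intro u c hu hc
    rw [← lintegral_const_mul _ (hu.const_mul _).ennreal_ofReal]
    refine lintegral_congr fun x => ?_
    rw [← ENNReal.ofReal_mul hc.le, mul_inv_cancel_left₀ hc.ne']
  rw [e f M hf hM, e g N hg hN, e h _ hh hc, ENNReal.mul_rpow_of_nonneg _ _ ha.le,
    ENNReal.mul_rpow_of_nonneg _ _ hb.le, mul_mul_mul_comm, ENNReal.ofReal_rpow_of_pos hM,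
    ENNReal.ofReal_rpow_of_pos hN, ← ENNReal.ofReal_mul (by positivity)]
  gcongr
  exact (ENNReal.rpow_mul_rpow_le_add ha hb hab _ _).trans this

/-- One-dimensional Prékopa–Leindler inequality. -/
theorem prekopa_leindler_real {f g h : ℝ → ENNReal} (hf : Measurable f) (hg : Measurable g)
    (hh : Measurable h) {a b : ℝ} (ha : 0 < a) (hb : 0 < b)
    (hab : a + b = 1) (H : ∀ x y, f x ^ a * g y ^ b ≤ h (a * x + b * y)) :
    (∫⁻ x, f x) ^ a * (∫⁻ x, g x) ^ b ≤ ∫⁻ x, h x := by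
  -- Truncating all three functions at `n` preserves the hypothesis because `n ^ a * n ^ b = n`.
  -- Monotone convergence removes the truncation.
  have hn : ∀ n : ℕ, (∫⁻ x, min (f x) n) ^ a * (∫⁻ x, min (g x) n) ^ b ≤ ∫⁻ x, h x := by
    intro n
    have fin : ∀ (u : ℝ → ENNReal) x, min (u x) n ≠ ⊤ := fun u x =>
      ne_top_of_le_ne_top (ENNReal.natCast_ne_top n) (min_le_right _ _)
    have bd : ∀ u : ℝ → ENNReal, BddAbove (range fun x => (min (u x) n).toReal) := by
      refine fun u => ⟨n, ?_⟩
      rintro _ ⟨x, rfl⟩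
      simpa using ENNReal.toReal_mono (ENNReal.natCast_ne_top n) (min_le_right (u x) (n : ENNReal))
    have := prekopa_leindler_of_bounded (hf.min measurable_const).ennreal_toReal
      (hg.min measurable_const).ennreal_toReal (hh.min measurable_const).ennreal_toReal
      (fun _ => ENNReal.toReal_nonneg) (fun _ => ENNReal.toReal_nonneg)
      (fun _ => ENNReal.toReal_nonneg) (bd f) (bd g) ha hb hab (fun x y => by
        rw [ENNReal.toReal_rpow, ENNReal.toReal_rpow, ← ENNReal.toReal_mul]
        refine ENNReal.toReal_mono (fin h _) (le_min ?_ ?_)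
        · refine le_trans ?_ (H x y)
          gcongr <;> exact min_le_left _ _
        · calc _ ≤ (n : ENNReal) ^ a * (n : ENNReal) ^ b := by
                gcongr <;> exact min_le_right _ _
            _ = n := by
                rw [← ENNReal.rpow_add_of_nonneg _ _ ha.le hb.le, hab, ENNReal.rpow_one])
    simp only [ENNReal.ofReal_toReal (fin _ _)] at this
    exact this.trans (lintegral_mono fun x => min_le_left _ _)
  have lim : ∀ (u : ℝ → ENNReal) (c : ℝ), Measurable u → 
      Filter.Tendsto (fun n : ℕ => (∫⁻ x, min (u x) n) ^ c) Filter.atTop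
        (nhds ((∫⁻ x, u x) ^ c)) := by
    intro u c hu
    refine (ENNReal.continuous_rpow_const.tendsto _).comp ?_
    refine lintegral_tendsto_of_tendsto_of_monotone
      (fun n => (hu.min measurable_const).aemeasurable) (ae_of_all _ fun x m n hmn => ?_)
      (ae_of_all _ fun x => ?_)
    · simp only
      gcongr
    · have := (tendsto_const_nhds (x := u x)).min ENNReal.tendsto_nat_nhds_top
      simpa using this
  refine ENNReal.mul_le_of_forall_lt fun p hp q hq => ?_
  obtain ⟨n, h1, h2⟩ := (((lim f a hf).eventually (lt_mem_nhds hp)).and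
    ((lim g b hg).eventually (lt_mem_nhds hq))).exists
  exact (mul_le_mul' h1.le h2.le).trans (hn n)

theorem measurable_fin_cons {m : ℕ} :
    Measurable fun z : ℝ × (Fin m → ℝ) => (Fin.cons z.1 z.2 : Fin (m + 1) → ℝ) := by
  refine measurable_pi_iff.2 fun i => ?_
  refine Fin.cases ?_ (fun j => ?_) i
  · simpa using measurable_fst
  · simp only [Fin.cons_succ]
    exact (measurable_pi_apply j).comp measurable_snd

theorem lintegral_fin_succ {m : ℕ} {f : (Fin (m + 1) → ℝ) → ENNReal} (hf : Measurable f) :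
    ∫⁻ z, f z = ∫⁻ x : ℝ, ∫⁻ v : Fin m → ℝ, f (Fin.cons x v) := by
  have h := (volume_preserving_piFinSuccAbove (fun _ : Fin (m + 1) => ℝ) 0).symm
  rw [← h.lintegral_comp hf]
  have e : ∀ z : ℝ × (Fin m → ℝ),
      (MeasurableEquiv.piFinSuccAbove (fun _ : Fin (m + 1) => ℝ) 0).symm z =
        Fin.cons z.1 z.2 := fun z => by
    rw [← Fin.insertNth_zero']
    rfl
  simp only [e]
  exact lintegral_prod _ (hf.comp measurable_fin_cons).aemeasurable

/-- Prékopa–Leindler inequality on `ℝᵐ`. -/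
theorem prekopa_leindler_pi {m : ℕ} {f g h : (Fin m → ℝ) → ENNReal} (hf : Measurable f)
    (hg : Measurable g) (hh : Measurable h) {a b : ℝ} (ha : 0 < a) (hb : 0 < b)
    (hab : a + b = 1) (H : ∀ x y, f x ^ a * g y ^ b ≤ h (a • x + b • y)) :
    (∫⁻ x, f x) ^ a * (∫⁻ x, g x) ^ b ≤ ∫⁻ x, h x := by
  induction m with
  | zero =>
    have e : ∀ u : (Fin 0 → ℝ) → ENNReal, Measurable u → ∫⁻ x, u x = u 0 := fun u hu => by
      rw [volume_pi, Measure.pi_of_empty _ 0, lintegral_dirac' _ hu]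
    rw [e f hf, e g hg, e h hh]
    simpa using H 0 0
  | succ m ih =>
    have mc : ∀ u : (Fin (m + 1) → ℝ) → ENNReal, Measurable u →
        Measurable fun z : ℝ × (Fin m → ℝ) => u (Fin.cons z.1 z.2) := fun u hu =>
      hu.comp measurable_fin_cons
    rw [lintegral_fin_succ hf, lintegral_fin_succ hg, lintegral_fin_succ hh]
    -- The one-dimensional inequality applies to the integrals over the last `m` coordinates; its
    -- hypothesis for them is the induction hypothesis.
    refine prekopa_leindler_real (mc f hf).lintegral_prod_right (mc g hg).lintegral_prod_right
      (mc h hh).lintegral_prod_right ha hb hab fun x y => ?_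
    refine ih ((mc f hf).comp measurable_prodMk_left) ((mc g hg).comp measurable_prodMk_left)
      ((mc h hh).comp measurable_prodMk_left) fun v w => ?_
    refine (H _ _).trans (le_of_eq (congrArg h ?_))
    ext i
    refine Fin.cases ?_ (fun j => ?_) i <;> simp

/-- Brunn's theorem: sections of a convex body have log-concave volume. -/
theorem volume_section_logConcave {E F : Type*} [NormedAddCommGroup E] [InnerProductSpace ℝ E]
    [FiniteDimensional ℝ E] [MeasurableSpace E] [BorelSpace E] [AddCommGroup F] [Module ℝ F]
    {K : Set (E × F)} (hK : Convex ℝ K) (hm : ∀ y, MeasurableSet {x | (x, y) ∈ K})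
    {a b : ℝ} (ha : 0 < a) (hb : 0 < b) (hab : a + b = 1) (y z : F) :
    volume {x | (x, y) ∈ K} ^ a * volume {x | (x, z) ∈ K} ^ b ≤
      volume {x | (x, a • y + b • z) ∈ K} := by
  set ι := stdOrthonormalBasis ℝ E
  have mp : MeasurePreserving fun v : Fin (Module.finrank ℝ E) → ℝ =>
      ι.repr.symm (WithLp.toLp 2 v) :=
    ι.repr.symm.measurePreserving.comp (PiLp.volume_preserving_toLp _)
  have ev : ∀ y, volume {x | (x, y) ∈ K} = ∫⁻ v : Fin (Module.finrank ℝ E) → ℝ,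
      ({x | (x, y) ∈ K}.indicator 1 (ι.repr.symm (WithLp.toLp 2 v)) : ENNReal) := by
    intro y
    rw [mp.lintegral_comp (f := {x | (x, y) ∈ K}.indicator 1) (measurable_one.indicator (hm y)),
      lintegral_indicator_one (hm y)]
  have em : ∀ y, Measurable fun v : Fin (Module.finrank ℝ E) → ℝ =>
      ({x | (x, y) ∈ K}.indicator 1 (ι.repr.symm (WithLp.toLp 2 v)) : ENNReal) := fun y =>
    (measurable_one.indicator (hm y)).comp mp.measurable
  rw [ev, ev, ev]
  -- For indicators of the three sections the hypothesis of Prékopa–Leindler is the convexity of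
  -- `K`.
  refine prekopa_leindler_pi (em _) (em _) (em _) ha hb hab fun v w => ?_
  by_cases h1 : ι.repr.symm (WithLp.toLp 2 v) ∈ {x | (x, y) ∈ K}
  · by_cases h2 : ι.repr.symm (WithLp.toLp 2 w) ∈ {x | (x, z) ∈ K}
    · have h3 := hK h1 h2 ha.le hb.le hab
      have : ι.repr.symm (WithLp.toLp 2 (a • v + b • w)) ∈ {x | (x, a • y + b • z) ∈ K} := by
        simpa using h3
      rw [indicator_of_mem h1, indicator_of_mem h2, indicator_of_mem this]
      simp
    · rw [indicator_of_notMem h2]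
      simp [hb]
  · rw [indicator_of_notMem h1]
    simp [ha]

/-! ### Monotone transport and Ball's inequality. -/

theorem strictMonoOn_integral_of_pos {R : ℝ} {v : ℝ → ℝ}
    (hv : ∀ r ∈ Ioo 0 R, 0 < v r) (hi : IntegrableOn v (Ioo 0 R)) :
    StrictMonoOn (fun r => ∫ t in (0 : ℝ)..r, v t) (Icc 0 R) := by
  intro x hx y hy hxy
  have ii : ∀ z ∈ Icc 0 R, IntervalIntegrable v volume 0 z := fun z hz => by
    rw [intervalIntegrable_iff_integrableOn_Ioo_of_le hz.1]
    exact hi.mono_set (Ioo_subset_Ioo_right hz.2)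
  have := intervalIntegral.integral_add_adjacent_intervals (ii x hx) ((ii x hx).symm.trans (ii y hy))
  have pos : 0 < ∫ t in x..y, v t :=
    intervalIntegral.intervalIntegral_pos_of_pos_on ((ii x hx).symm.trans (ii y hy))
      (fun t ht => hv t ⟨hx.1.trans_lt ht.1, ht.2.trans_le hy.2⟩) hxy
  simp only
  linarith

theorem continuousOn_integral_Icc {R : ℝ} {v : ℝ → ℝ} (hR : 0 ≤ R)
    (hi : IntegrableOn v (Ioo 0 R)) :
    ContinuousOn (fun r => ∫ t in (0 : ℝ)..r, v t) (Icc 0 R) := by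
  have := intervalIntegral.continuousOn_primitive_interval (f := v) (μ := volume) (a := 0) (b := R)
    (by rw [uIcc_of_le hR, integrableOn_Icc_iff_integrableOn_Ioo]; exact hi)
  rwa [uIcc_of_le hR] at this

theorem hasDerivAt_integral_of_continuousOn_Ioo {R : ℝ} {v : ℝ → ℝ}
    (hc : ContinuousOn v (Ioo 0 R)) (hi : IntegrableOn v (Ioo 0 R)) {r : ℝ} (hr : r ∈ Ioo 0 R) :
    HasDerivAt (fun r => ∫ t in (0 : ℝ)..r, v t) (v r) r := by
  refine intervalIntegral.integral_hasDerivAt_right ?_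
    (hc.stronglyMeasurableAtFilter isOpen_Ioo r hr) (hc.continuousAt (isOpen_Ioo.mem_nhds hr))
  rw [intervalIntegrable_iff_integrableOn_Ioo_of_le hr.1.le]
  exact hi.mono_set (Ioo_subset_Ioo_right hr.2.le)

/-- Monotone transport between two positive densities with the same mass. -/
theorem exists_transport {R S : ℝ} (hR : 0 < R) (hS : 0 < S) {u v : ℝ → ℝ}
    (hu : ∀ r ∈ Ioo 0 R, 0 < u r) (hv : ∀ r ∈ Ioo 0 S, 0 < v r)
    (hcu : ContinuousOn u (Ioo 0 R)) (hcv : ContinuousOn v (Ioo 0 S))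
    (hiu : IntegrableOn u (Ioo 0 R)) (hiv : IntegrableOn v (Ioo 0 S))
    (h : ∫ t in (0 : ℝ)..R, u t = ∫ t in (0 : ℝ)..S, v t) :
    ∃ T : ℝ → ℝ, ∀ r ∈ Ioo 0 R, T r ∈ Ioo 0 S ∧ HasDerivAt T (u r / v (T r)) r := by
  set U := fun r => ∫ t in (0 : ℝ)..r, u t with hU
  set V := fun r => ∫ t in (0 : ℝ)..r, v t with hV
  have mU : StrictMonoOn U (Icc 0 R) := strictMonoOn_integral_of_pos hu hiu
  have mV : StrictMonoOn V (Icc 0 S) := strictMonoOn_integral_of_pos hv hiv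
  have U0 : U 0 = 0 := by simp [hU]
  have V0 : V 0 = 0 := by simp [hV]
  have hUV : U R = V S := h
  have inv : ∀ c ∈ Ioo (V 0) (V S), ∃ s ∈ Ioo 0 S, V s = c := fun c hc =>
    intermediate_value_Ioo hS.le (continuousOn_integral_Icc hS.le hiv) hc
  -- `W` is the inverse of `V`, and the transport map is `W ∘ U`, the solution of `V (T r) = U r`.
  -- Continuity of `W` comes from strict monotonicity of `V`.
  choose! W hW hVW using inv
  have cW : ∀ c ∈ Ioo (V 0) (V S), ContinuousAt W c := by
    intro c hc
    have hs := hW c hc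
    have hVc := hVW c hc
    refine tendsto_order.2 ⟨fun x hx => ?_, fun x hx => ?_⟩
    · have hm : max x 0 < W c := max_lt hx hs.1
      have hmem : max x 0 ∈ Icc 0 S := ⟨le_max_right _ _, hm.le.trans hs.2.le⟩
      have h1 : V (max x 0) < c := hVc ▸ mV hmem (Ioo_subset_Icc_self hs) hm
      filter_upwards [Ioo_mem_nhds h1 hc.2, Ioo_mem_nhds hc.1 hc.2] with d hd hd'
      have h2 : V (max x 0) < V (W d) := (hVW d hd').symm ▸ hd.1
      exact (le_max_left _ _).trans_lt
        ((mV.lt_iff_lt hmem (Ioo_subset_Icc_self (hW d hd'))).1 h2)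
    · have hm : W c < min x S := lt_min hx hs.2
      have hmem : min x S ∈ Icc 0 S := ⟨hs.1.le.trans hm.le, min_le_right _ _⟩
      have h1 : c < V (min x S) := hVc ▸ mV (Ioo_subset_Icc_self hs) hmem hm
      filter_upwards [Ioo_mem_nhds hc.1 h1, Ioo_mem_nhds hc.1 hc.2] with d hd hd'
      have h2 : V (W d) < V (min x S) := (hVW d hd').symm ▸ hd.2
      exact ((mV.lt_iff_lt (Ioo_subset_Icc_self (hW d hd')) hmem).1 h2).trans_le (min_le_left _ _)
  refine ⟨W ∘ U, fun r hr => ?_⟩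
  have hUr : U r ∈ Ioo (V 0) (V S) := by
    rw [V0, ← U0, ← hUV]
    exact ⟨mU ⟨le_rfl, hR.le⟩ (Ioo_subset_Icc_self hr) hr.1,
      mU (Ioo_subset_Icc_self hr) ⟨hR.le, le_rfl⟩ hr.2⟩
  have hWr := hW _ hUr
  refine ⟨hWr, ?_⟩
  have d1 : HasDerivAt W (v (W (U r)))⁻¹ (U r) :=
    HasDerivAt.of_local_left_inverse (cW _ hUr)
      (hasDerivAt_integral_of_continuousOn_Ioo hcv hiv hWr) (hv _ hWr).ne'
      (by filter_upwards [Ioo_mem_nhds hUr.1 hUr.2] with d hd using hVW d hd)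
  have := d1.comp r (hasDerivAt_integral_of_continuousOn_Ioo hcu hiu hr)
  rwa [inv_mul_eq_div] at this

/-- This is convexity of `x log x` at the points `1 / r` and `1 / s` with weights `a` and `b`. -/
theorem rpow_mul_rpow_le_harmonic {a b r s w : ℝ} (ha : 0 < a) (hb : 0 < b) (hab : a + b = 1)
    (hr : 0 < r) (hs : 0 < s) (hw : w = (a / r + b / s)⁻¹) :
    r ^ (a * w / r) * s ^ (b * w / s) ≤ w := by
  have hw0 : 0 < w := by rw [hw]; positivity
  have hw1 : a * r⁻¹ + b * s⁻¹ = w⁻¹ := by rw [hw, inv_inv]; ring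
  have := Real.convexOn_mul_log.2 (x := r⁻¹) (y := s⁻¹) (by simp; positivity) (by simp; positivity)
    ha.le hb.le hab
  simp only [smul_eq_mul, hw1, Real.log_inv] at this
  rw [← Real.log_le_log_iff (by positivity) hw0, Real.log_mul (by positivity) (by positivity),
    Real.log_rpow hr, Real.log_rpow hs]
  have h2 := mul_le_mul_of_nonneg_left this hw0.le
  have e : w * (w⁻¹ * -Real.log w) = - Real.log w := by field_simp
  rw [e] at h2
  have e2 : w * (a * (r⁻¹ * -Real.log r) + b * (s⁻¹ * -Real.log s)) =
    -(a * w / r * Real.log r + b * w / s * Real.log s) := by ring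
  linarith

/-- The transport step of Ball's inequality at one point. With `s = T r` the quotient `x r ^ q / (y
s ^ q)` is `T' r`, and the factor before the last bracket is the derivative of the harmonic mean `w
r = (a / r + b / T r)⁻¹`. That derivative is `w * (α / r + β * z)`. The arithmetic-geometric mean
inequality bounds it below, `w` is bounded below by `r ^ α * s ^ β`, and since `α + β = 1` all
powers of `s` and `y` cancel. -/
theorem ball_pointwise {a b r s w x y : ℝ} (q : ℕ) (ha : 0 < a) (hb : 0 < b) (hab : a + b = 1)
    (hr : 0 < r) (hs : 0 < s) (hw : w = (a / r + b / s)⁻¹) (hx : 0 < x) (hy : 0 < y) :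
    x * r ^ q ≤ w ^ 2 * (a / r ^ 2 + b * (x * r ^ q / (y * s ^ q)) / s ^ 2) *
      (x ^ (a * w / r) * y ^ (b * w / s) * w ^ q) := by
  have hw0 : 0 < w := by rw [hw]; positivity
  have hw1 : a / r + b / s = w⁻¹ := by rw [hw, inv_inv]
  set α := a * w / r with hα
  set β := b * w / s with hβ
  have hα0 : 0 < α := by positivity
  have hβ0 : 0 < β := by positivity
  have hαβ : α + β = 1 := by
    have : α + β = w * (a / r + b / s) := by rw [hα, hβ]; ring
    rw [this, hw1, mul_inv_cancel₀ hw0.ne']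
  set z := x * r ^ q / (y * s ^ (q + 1)) with hz
  have hz0 : 0 < z := by positivity
  have e1 : w ^ 2 * (a / r ^ 2 + b * (x * r ^ q / (y * s ^ q)) / s ^ 2) =
      w * (α * r⁻¹ + β * z) := by
    rw [hα, hβ, hz, pow_succ]; field_simp; ring
  have h1 : r⁻¹ ^ α * z ^ β ≤ α * r⁻¹ + β * z :=
    Real.geom_mean_le_arith_mean2_weighted hα0.le hβ0.le (by positivity) hz0.le hαβ
  have h2 : r ^ α * s ^ β ≤ w := rpow_mul_rpow_le_harmonic ha hb hab hr hs hw
  rw [e1]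
  calc x * r ^ q = (r ^ α * s ^ β) ^ (q + 1) * (r⁻¹ ^ α * z ^ β) * (x ^ α * y ^ β) := by
        rw [← Real.exp_log (show 0 < x * r ^ q by positivity),
          ← Real.exp_log (show 0 < (r ^ α * s ^ β) ^ (q + 1) * (r⁻¹ ^ α * z ^ β) * (x ^ α * y ^ β)
            by positivity)]
        congr 1
        rw [hz]
        simp only [Real.log_mul, Real.log_pow, Real.log_rpow, Real.log_div, Real.log_inv, hx, hy,
          hr, hs, hx.ne', hy.ne', hr.ne', hs.ne', ne_eq, not_false_eq_true, mul_eq_zero, or_self,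
          pow_eq_zero_iff', false_and, inv_pos,
          (by positivity : (r ^ α * s ^ β) ^ (q + 1) ≠ 0),
          (by positivity : r ^ α ≠ 0), (by positivity : s ^ β ≠ 0), (by positivity : x ^ α ≠ 0),
          (by positivity : y ^ β ≠ 0), (by positivity : r⁻¹ ^ α ≠ 0),
          (by positivity : (x * r ^ q / (y * s ^ (q + 1))) ^ β ≠ 0),
          (by positivity : 0 < x * r ^ q / (y * s ^ (q + 1)))]
        have : β = 1 - α := by linarith
        rw [this]
        push_cast
        ring
    _ ≤ w ^ (q + 1) * (α * r⁻¹ + β * z) * (x ^ α * y ^ β) := by gcongr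
    _ = _ := by ring

theorem exists_integral_eq_of_le {R A : ℝ} (hR : 0 < R) (hA : 0 < A) {v : ℝ → ℝ}
    (hi : IntegrableOn v (Ioo 0 R)) (h : A ≤ ∫ t in (0 : ℝ)..R, v t) :
    ∃ S, 0 < S ∧ S ≤ R ∧ ∫ t in (0 : ℝ)..S, v t = A := by
  obtain ⟨S, hS, hSA⟩ := intermediate_value_Icc hR.le (continuousOn_integral_Icc hR.le hi)
    (show A ∈ Icc _ _ from ⟨by simpa using hA.le, h⟩)
  refine ⟨S, lt_of_le_of_ne hS.1 ?_, hS.2, hSA⟩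
  rintro rfl
  simp at hSA
  exact hA.ne hSA

/-- K. Ball's inequality for the functional `(∫ r^q f(r) dr)^{-1/(q+1)}`. -/
theorem ball_inequality {a b R S A : ℝ} (q : ℕ) (ha : 0 < a) (hb : 0 < b) (hab : a + b = 1)
    (hR : 0 < R) (hS : 0 < S) (hA : 0 < A) {f g h : ℝ → ℝ}
    (hf : ∀ r ∈ Ioo 0 R, 0 < f r) (hg : ∀ r ∈ Ioo 0 S, 0 < g r)
    (hcf : ContinuousOn f (Ioo 0 R)) (hcg : ContinuousOn g (Ioo 0 S))
    (hif : IntegrableOn (fun r => f r * r ^ q) (Ioo 0 R))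
    (hig : IntegrableOn (fun r => g r * r ^ q) (Ioo 0 S))
    (hAf : A ≤ ∫ r in (0 : ℝ)..R, f r * r ^ q) (hAg : A ≤ ∫ r in (0 : ℝ)..S, g r * r ^ q)
    (H : ∀ r ∈ Ioo 0 R, ∀ s ∈ Ioo 0 S, ∀ w, w = (a / r + b / s)⁻¹ →
      f r ^ (a * w / r) * g s ^ (b * w / s) ≤ h w) :
    ENNReal.ofReal A ≤ ∫⁻ w in Ioi 0, ENNReal.ofReal (h w * w ^ q) := by
  -- Both intervals are shortened until the two masses equal `A`, as transport needs equal masses.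
  obtain ⟨R', hR', hRR, hRA⟩ := exists_integral_eq_of_le hR hA hif hAf
  obtain ⟨S', hS', hSS, hSA⟩ := exists_integral_eq_of_le hS hA hig hAg
  have sR : Ioo 0 R' ⊆ Ioo 0 R := Ioo_subset_Ioo_right hRR
  have sS : Ioo 0 S' ⊆ Ioo 0 S := Ioo_subset_Ioo_right hSS
  have hu : ∀ r ∈ Ioo 0 R', 0 < f r * r ^ q := fun r hr =>
    mul_pos (hf r (sR hr)) (pow_pos hr.1 q)
  have hv : ∀ r ∈ Ioo 0 S', 0 < g r * r ^ q := fun r hr =>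
    mul_pos (hg r (sS hr)) (pow_pos hr.1 q)
  obtain ⟨T, hT⟩ := exists_transport hR' hS' hu hv
    ((hcf.mono sR).mul (continuous_pow q).continuousOn)
    ((hcg.mono sS).mul (continuous_pow q).continuousOn) (hif.mono_set sR) (hig.mono_set sS)
    (hRA.trans hSA.symm)
  set w : ℝ → ℝ := fun r => (a / r + b / T r)⁻¹ with hw
  set w' : ℝ → ℝ := fun r => w r ^ 2 * (a / r ^ 2 +
    b * (f r * r ^ q / (g (T r) * T r ^ q)) / T r ^ 2) with hw'
  have wpos : ∀ r ∈ Ioo 0 R', 0 < w r := fun r hr => by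
    have h1 := hr.1
    have h2 := (hT r hr).1.1
    positivity
  have w'pos : ∀ r ∈ Ioo 0 R', 0 < w' r := fun r hr => by
    have h1 := hr.1
    have h2 := (hT r hr).1.1
    have h3 := wpos r hr
    have h4 := hu r hr
    have h5 := hv _ (hT r hr).1
    positivity
  have dw : ∀ r ∈ Ioo 0 R', HasDerivAt w (w' r) r := fun r hr => by
    have h1 := hr.1
    obtain ⟨⟨h2, _⟩, h3⟩ := hT r hr
    have hs : a / r + b / T r ≠ 0 := by positivity
    have := (((hasDerivAt_id r).inv h1.ne').const_mul a).add ((h3.inv h2.ne').const_mul b)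
    have h4 := HasDerivAt.inv this (by simpa [div_eq_mul_inv] using hs)
    refine (h4.congr_deriv ?_).congr_of_eventuallyEq (Filter.Eventually.of_forall fun x => ?_)
    · simp only [hw', hw, id, Pi.add_apply, Pi.inv_apply, div_eq_mul_inv, inv_pow]
      ring
    · simp [hw, div_eq_mul_inv]
  have mono : StrictMonoOn w (Ioo 0 R') := by
    refine strictMonoOn_of_deriv_pos (convex_Ioo _ _)
      (fun r hr => (dw r hr).continuousAt.continuousWithinAt) fun r hr => ?_
    rw [interior_Ioo] at hr
    rw [(dw r hr).deriv]
    exact w'pos r hr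
  calc ENNReal.ofReal A = ∫⁻ r in Ioo 0 R', ENNReal.ofReal (f r * r ^ q) := by
        rw [← ofReal_integral_eq_lintegral_ofReal (hif.mono_set sR)
          ((ae_restrict_iff' measurableSet_Ioo).2 (ae_of_all _ fun r hr => (hu r hr).le)),
          ← hRA, intervalIntegral.integral_of_le hR'.le, integral_Ioc_eq_integral_Ioo]
    _ ≤ ∫⁻ r in Ioo 0 R', ENNReal.ofReal |w' r| * ENNReal.ofReal (h (w r) * w r ^ q) := by
        refine setLIntegral_mono_ae' measurableSet_Ioo (ae_of_all _ fun r hr => ?_)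
        have h1 := w'pos r hr
        have h2 := wpos r hr
        obtain ⟨h3, _⟩ := hT r hr
        rw [abs_of_pos h1, ← ENNReal.ofReal_mul h1.le]
        refine ENNReal.ofReal_le_ofReal ((ball_pointwise q ha hb hab hr.1 h3.1 rfl
          (hf r (sR hr)) (hg _ (sS h3))).trans ?_)
        exact mul_le_mul_of_nonneg_left (mul_le_mul_of_nonneg_right
          (H r (sR hr) _ (sS h3) _ rfl) (by positivity)) h1.le
    -- Change of variables along the strictly increasing map `w`.
    _ = ∫⁻ x in w '' Ioo 0 R', ENNReal.ofReal (h x * x ^ q) :=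
        (lintegral_image_eq_lintegral_abs_deriv_mul measurableSet_Ioo
          (fun r hr => (dw r hr).hasDerivWithinAt) mono.injOn
          (fun x => ENNReal.ofReal (h x * x ^ q))).symm
    _ ≤ _ := lintegral_mono_set (by rintro _ ⟨r, hr, rfl⟩; exact wpos r hr)

/-! ### Moments of log-concave functions on the half line. -/

theorem integral_exp_mul_pow (j : ℕ) {a : ℝ} (ha : 0 < a) :
    ∫ r in Ioi (0 : ℝ), Real.exp (-(a * r)) * r ^ j = j.factorial / a ^ (j + 1) := by
  have := Real.integral_rpow_mul_exp_neg_mul_Ioi (a := j + 1) (r := a) (by positivity) ha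
  rw [Real.Gamma_nat_eq_factorial] at this
  calc _ = ∫ r in Ioi (0 : ℝ), r ^ ((j : ℝ) + 1 - 1) * Real.exp (-(a * r)) := by
        refine setIntegral_congr_fun measurableSet_Ioi fun r hr => ?_
        simp only [add_sub_cancel_right, Real.rpow_natCast]
        ring
    _ = _ := by
        rw [this, one_div, Real.inv_rpow ha.le, inv_mul_eq_div]
        congr 1
        exact_mod_cast Real.rpow_natCast a (j + 1)

theorem integrableOn_exp_mul_pow (j : ℕ) {a : ℝ} (ha : 0 < a) :
    IntegrableOn (fun r => Real.exp (-(a * r)) * r ^ j) (Ioi (0 : ℝ)) := by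
  -- A non-integrable function would have integral 0 by convention, but the integral is positive.
  by_contra h
  have h1 := integral_exp_mul_pow j ha
  rw [integral_undef h] at h1
  have : 0 < (j.factorial : ℝ) / a ^ (j + 1) := by positivity
  linarith

theorem integrableOn_mul_pow_of_bounded {f : ℝ → ℝ} (hm : Measurable f) (h0 : ∀ r, 0 ≤ f r)
    {B : ℝ} (h1 : ∀ r, f r ≤ B) {R : ℝ} (hR : ∀ r, R < r → f r = 0) (j : ℕ) :
    IntegrableOn (fun r => f r * r ^ j) (Ioi (0 : ℝ)) := by
  have : IntegrableOn (fun r => f r * r ^ j) (Ioc 0 R) := by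
    refine Measure.integrableOn_of_bounded (M := B * R ^ j) (by simp)
      (hm.mul (measurable_id.pow_const j)).aestronglyMeasurable ?_
    filter_upwards [ae_restrict_mem measurableSet_Ioc] with r hr
    have := hr.1
    rw [Real.norm_of_nonneg (mul_nonneg (h0 r) (by positivity))]
    exact mul_le_mul (h1 r) (pow_le_pow_left₀ hr.1.le hr.2 j) (by positivity) ((h0 r).trans (h1 r))
  refine this.of_forall_sdiff_eq_zero measurableSet_Ioi fun r hr => ?_
  have : R < r := by
    by_contra hc
    exact hr.2 ⟨hr.1, not_lt.1 hc⟩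
  simp [hR r this]

/-- Reverse Hölder inequality for moments of a log-concave function on the half line, by
comparison with an exponential. -/
theorem moment_comparison {f : ℝ → ℝ} (hm : Measurable f) (h0 : ∀ r, 0 ≤ f r)
    (h1 : ∀ r, f r ≤ 1) {R : ℝ} (hR : ∀ r, R < r → f r = 0)
    (hlc : ∀ r, 0 < r → ∀ t, 0 < t → t < 1 → f r ^ t ≤ f (t * r)) (j : ℕ) {a : ℝ} (ha : 0 < a)
    (hI : ∫ r in Ioi (0 : ℝ), f r * r ^ j = j.factorial / a ^ (j + 1)) :
    ∫ r in Ioi (0 : ℝ), f r * r ^ (j + 2) ≤ (j + 2).factorial / a ^ (j + 3) := by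
  -- By log-concavity `P` is an initial segment of the half line, so `f - exp(-a r)` changes sign at
  -- most once, from plus to minus, at `r₀ = sup P` (or 0 if `P` is empty).
  set P : Set ℝ := {r | 0 < r ∧ Real.exp (-(a * r)) ≤ f r} with hP
  have hPR : ∀ r ∈ P, r ≤ R := fun r hr => by
    by_contra hc
    have := hr.2
    rw [hR r (not_le.1 hc)] at this
    exact (Real.exp_pos _).not_ge this
  have hdown : ∀ r ∈ P, ∀ r', 0 < r' → r' < r → r' ∈ P := by
    intro r hr r' hr' hlt
    refine ⟨hr', ?_⟩
    have h2 := hlc r hr.1 (r' / r) (div_pos hr' hr.1) ((div_lt_one hr.1).2 hlt)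
    rw [div_mul_cancel₀ _ hr.1.ne'] at h2
    refine le_trans ?_ h2
    calc Real.exp (-(a * r')) = Real.exp (-(a * r)) ^ (r' / r) := by
          rw [← Real.exp_mul]
          congr 1
          have := hr.1.ne'
          field_simp
      _ ≤ _ := Real.rpow_le_rpow (Real.exp_pos _).le hr.2 (div_pos hr' hr.1).le
  obtain ⟨r₀, hr₀, hle, hge⟩ : ∃ r₀, 0 ≤ r₀ ∧ (∀ r, 0 < r → r < r₀ → Real.exp (-(a * r)) ≤ f r) ∧
      ∀ r, r₀ < r → f r ≤ Real.exp (-(a * r)) := by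
    rcases P.eq_empty_or_nonempty with he | hne
    · refine ⟨0, le_rfl, fun r h h' => absurd h' h.not_gt, fun r hr => ?_⟩
      by_contra hc
      have : r ∈ P := ⟨hr, (not_le.1 hc).le⟩
      simp [he] at this
    · have hl := isLUB_csSup hne ⟨R, hPR⟩
      obtain ⟨p, hp⟩ := hne
      have hp0 : 0 < sSup P := hp.1.trans_le (hl.1 hp)
      refine ⟨_, hp0.le, fun r hr hlt => ?_, fun r hr => ?_⟩
      · obtain ⟨p', hp', hlt'⟩ := (lt_isLUB_iff hl).1 hlt
        exact (hdown p' hp' r hr hlt').2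
      · by_contra hc
        exact (hl.1 (show r ∈ P from ⟨hp0.trans hr, (not_le.1 hc).le⟩)).not_gt hr
  have if1 := integrableOn_mul_pow_of_bounded hm h0 h1 hR j
  have if2 := integrableOn_mul_pow_of_bounded hm h0 h1 hR (j + 2)
  have ie1 := integrableOn_exp_mul_pow j ha
  have ie2 := integrableOn_exp_mul_pow (j + 2) ha
  -- Pointwise `(r ^ 2 - r₀ ^ 2) * (f r - exp(-a r)) ≤ 0`. The right-hand integral vanishes because
  -- the moments of order `j` agree.
  have key : ∫ r in Ioi (0 : ℝ), (f r * r ^ (j + 2) - Real.exp (-(a * r)) * r ^ (j + 2)) ≤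
      ∫ r in Ioi (0 : ℝ), r₀ ^ 2 * (f r * r ^ j - Real.exp (-(a * r)) * r ^ j) := by
    refine setIntegral_mono_on (if2.sub ie2) ((if1.sub ie1).const_mul _) measurableSet_Ioi
      fun r hr => ?_
    have hr' : (0 : ℝ) < r := hr
    have hj : 0 < r ^ j := by positivity
    have : (r ^ 2 - r₀ ^ 2) * (f r - Real.exp (-(a * r))) ≤ 0 := by
      rcases lt_trichotomy r r₀ with h | h | h
      · exact mul_nonpos_of_nonpos_of_nonneg (by nlinarith) (sub_nonneg.2 (hle r hr' h))
      · simp [h]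
      · exact mul_nonpos_of_nonneg_of_nonpos (by nlinarith) (sub_nonpos.2 (hge r h))
    have h3 := mul_nonpos_of_nonpos_of_nonneg this hj.le
    rw [pow_add]
    linarith
  rw [integral_sub if2 ie2, integral_const_mul, integral_sub if1 ie1, hI,
    integral_exp_mul_pow j ha, integral_exp_mul_pow (j + 2) ha] at key
  linarith

/-! ### Polar coordinates and Ball's set of an even log-concave function. -/

theorem lintegral_eq_lintegral_sphere {E : Type*} [NormedAddCommGroup E] [NormedSpace ℝ E]
    [MeasurableSpace E] [BorelSpace E] [FiniteDimensional ℝ E] [Nontrivial E]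
    (μ : Measure E) [μ.IsAddHaarMeasure] {f : E → ENNReal} (hf : Measurable f) :
    ∫⁻ x, f x ∂μ = ∫⁻ θ : sphere (0 : E) 1, (∫⁻ r in Ioi (0 : ℝ),
      ENNReal.ofReal (r ^ (Module.finrank ℝ E - 1)) * f (r • (θ : E))) ∂μ.toSphere := by
  have mp := μ.measurePreserving_homeomorphUnitSphereProd
  have hF : Measurable fun z : sphere (0 : E) 1 × Ioi (0 : ℝ) => f ((z.2 : ℝ) • (z.1 : E)) :=
    hf.comp ((measurable_subtype_coe.comp measurable_snd).smul
      (measurable_subtype_coe.comp measurable_fst))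
  calc ∫⁻ x, f x ∂μ = ∫⁻ x : ({(0)}ᶜ : Set E), f x ∂(μ.comap (↑)) := by
        rw [lintegral_subtype_comap (measurableSet_singleton _).compl, restrict_compl_singleton]
    _ = ∫⁻ x : ({(0)}ᶜ : Set E), (fun z : sphere (0 : E) 1 × Ioi (0 : ℝ) =>
          f ((z.2 : ℝ) • (z.1 : E))) (homeomorphUnitSphereProd E x) ∂(μ.comap (↑)) := by
        refine lintegral_congr fun x => ?_
        have : ‖(x : E)‖ ≠ 0 := norm_ne_zero_iff.2 x.2
        simp [smul_smul, this]
    _ = ∫⁻ z, f ((z.2 : ℝ) • (z.1 : E))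
          ∂(μ.toSphere.prod (.volumeIoiPow (Module.finrank ℝ E - 1))) := mp.lintegral_comp hF
    _ = ∫⁻ θ : sphere (0 : E) 1, (∫⁻ r : Ioi (0 : ℝ), f ((r : ℝ) • (θ : E))
          ∂(.volumeIoiPow (Module.finrank ℝ E - 1))) ∂μ.toSphere :=
        lintegral_prod _ hF.aemeasurable
    _ = _ := by
        refine lintegral_congr fun θ => ?_
        rw [Measure.volumeIoiPow, lintegral_withDensity_eq_lintegral_mul _
          (by fun_prop) (show Measurable fun r : Ioi (0 : ℝ) => f ((r : ℝ) • (θ : E)) from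
            hF.comp measurable_prodMk_left)]
        exact lintegral_subtype_comap measurableSet_Ioi fun r : ℝ =>
          ENNReal.ofReal (r ^ (Module.finrank ℝ E - 1)) * f (r • (θ : E))

/-- An even log-concave function with bounded support which is bounded below near the origin. -/
structure IsEvenLogConcave {W : Type*} [NormedAddCommGroup W] [NormedSpace ℝ W]
    [MeasurableSpace W] (g : W → ℝ) : Prop where
  measurable : Measurable g
  nonneg : ∀ y, 0 ≤ g y
  neg : ∀ y, g (-y) = g y
  logConcave : ∀ a b : ℝ, 0 < a → 0 < b → a + b = 1 → ∀ y z,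
    g y ^ a * g z ^ b ≤ g (a • y + b • z)
  bounded_support : ∃ R, 0 < R ∧ ∀ y, R < ‖y‖ → g y = 0
  pos_near_zero : ∃ δ, 0 < δ ∧ ∃ c, 0 < c ∧ ∀ y, ‖y‖ ≤ δ → c ≤ g y

namespace IsEvenLogConcave

variable {W : Type*} [NormedAddCommGroup W] [NormedSpace ℝ W] [MeasurableSpace W] {g : W → ℝ}

/-- The origin is the midpoint of `y` and `-y`, where `g` takes equal values. -/
theorem le_zero (hg : IsEvenLogConcave g) (y : W) : g y ≤ g 0 := by
  have h := hg.logConcave (1 / 2) (1 / 2) (by norm_num) (by norm_num) (by norm_num) y (-y)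
  rw [hg.neg, ← Real.rpow_add_of_nonneg (hg.nonneg y) (by norm_num) (by norm_num),
    show (1 / 2 : ℝ) + 1 / 2 = 1 by norm_num, Real.rpow_one] at h
  simpa using h

theorem zero_pos (hg : IsEvenLogConcave g) : 0 < g 0 := by
  obtain ⟨δ, hδ, c, hc, h⟩ := hg.pos_near_zero
  exact hc.trans_le (h 0 (by simpa using hδ.le))

theorem rpow_le_smul (hg : IsEvenLogConcave g) (y : W) {t : ℝ} (ht : 0 < t) (ht1 : t < 1) :
    g y ^ t * g 0 ^ (1 - t) ≤ g (t • y) := by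
  simpa using hg.logConcave t (1 - t) ht (by linarith) (by ring) y 0

theorem le_smul (hg : IsEvenLogConcave g) (y : W) {t : ℝ} (ht : 0 < t) (ht1 : t < 1) :
    g y ≤ g (t • y) := by
  refine le_trans ?_ (hg.rpow_le_smul y ht ht1)
  calc g y = g y ^ t * g y ^ (1 - t) := by
        rw [← Real.rpow_add_of_nonneg (hg.nonneg y) ht.le (by linarith)]; simp
    _ ≤ g y ^ t * g 0 ^ (1 - t) := mul_le_mul_of_nonneg_left
        (Real.rpow_le_rpow (hg.nonneg y) (hg.le_zero y) (by linarith))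
        (Real.rpow_nonneg (hg.nonneg y) _)

theorem measurable_ray [BorelSpace W] (hg : IsEvenLogConcave g) (y : W) :
    Measurable fun r : ℝ => g (r • y) :=
  hg.measurable.comp (continuous_id.smul continuous_const).measurable

theorem ray_eq_zero (_hg : IsEvenLogConcave g) {R : ℝ} (h : ∀ y, R < ‖y‖ → g y = 0) {y : W}
    (hy : y ≠ 0) (hR : 0 < R) : ∀ r, R / ‖y‖ < r → g (r • y) = 0 := by
  intro r hr
  have hy' := norm_pos_iff.2 hy
  refine h _ ?_
  have hr0 : 0 < r := lt_trans (by positivity) hr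
  rwa [norm_smul, Real.norm_of_nonneg hr0.le, ← div_lt_iff₀ hy']

theorem integrableOn_ray [BorelSpace W] (hg : IsEvenLogConcave g) {y : W} (hy : y ≠ 0)
    (q : ℕ) : IntegrableOn (fun r : ℝ => g (r • y) * r ^ q) (Ioi 0) := by
  obtain ⟨R, hR, h⟩ := hg.bounded_support
  exact integrableOn_mul_pow_of_bounded (hg.measurable_ray y) (fun r => hg.nonneg _)
    (fun r => hg.le_zero _) (hg.ray_eq_zero h hy hR) q

/-- The moment of order `q` of `g` along the ray through `y`. -/
noncomputable def rayMoment (g : W → ℝ) (q : ℕ) (y : W) : ENNReal :=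
  ∫⁻ r in Ioi (0 : ℝ), ENNReal.ofReal (g (r • y) * r ^ q)

theorem rayMoment_eq [BorelSpace W] (hg : IsEvenLogConcave g) {y : W} (hy : y ≠ 0)
    (q : ℕ) : rayMoment g q y = ENNReal.ofReal (∫ r in Ioi (0 : ℝ), g (r • y) * r ^ q) := by
  rw [rayMoment, ofReal_integral_eq_lintegral_ofReal (hg.integrableOn_ray hy q)]
  filter_upwards [ae_restrict_mem measurableSet_Ioi] with r hr
  have : (0 : ℝ) < r := hr
  exact mul_nonneg (hg.nonneg _) (by positivity)

/-- Continuity is not assumed of `g`: it comes from concavity of `log g` along the ray on an open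
interval. -/
theorem continuousOn_ray (hg : IsEvenLogConcave g) {y : W} {R : ℝ}
    (hpos : ∀ r ∈ Ioo 0 R, 0 < g (r • y)) : ContinuousOn (fun r : ℝ => g (r • y)) (Ioo 0 R) := by
  have hc : ConcaveOn ℝ (Ioo 0 R) fun r : ℝ => Real.log (g (r • y)) := by
    refine concaveOn_iff_forall_pos.2 ⟨convex_Ioo _ _, fun r hr s hs a b ha hb hab => ?_⟩
    have h := hg.logConcave a b ha hb hab (r • y) (s • y)
    have h1 := hpos r hr
    have h2 := hpos s hs
    have h3 := Real.log_le_log (by positivity) h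
    rw [Real.log_mul (by positivity) (by positivity), Real.log_rpow h1, Real.log_rpow h2,
      smul_smul, smul_smul, ← add_smul] at h3
    simpa using h3
  exact (hc.continuousOn isOpen_Ioo).rexp.congr fun r hr => (Real.exp_log (hpos r hr)).symm

/-- Ball's set associated with `g`. -/
noncomputable def ballSet (g : W → ℝ) (q : ℕ) : Set W :=
  {y | ENNReal.ofReal (g 0 / (q + 1)) ≤ rayMoment g q y}

theorem integral_const_mul_pow (c M : ℝ) (q : ℕ) :
    ∫ r in (0 : ℝ)..M, c * r ^ q = c * M ^ (q + 1) / (q + 1) := by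
  rw [intervalIntegral.integral_const_mul, integral_pow]
  simp [mul_div_assoc]

theorem lintegral_const_mul_pow {c M : ℝ} (hc : 0 ≤ c) (hM : 0 ≤ M) (q : ℕ) :
    ∫⁻ r in Ioc (0 : ℝ) M, ENNReal.ofReal (c * r ^ q) =
      ENNReal.ofReal (c * M ^ (q + 1) / (q + 1)) := by
  rw [← integral_const_mul_pow, intervalIntegral.integral_of_le hM,
    ofReal_integral_eq_lintegral_ofReal]
  · exact (by fun_prop : Continuous fun r : ℝ => c * r ^ q).integrableOn_Icc.mono_set
      Ioc_subset_Icc_self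
  · filter_upwards [ae_restrict_mem measurableSet_Ioc] with r hr
    have := hr.1
    exact mul_nonneg hc (by positivity)

/-- Provides the data for `ball_inequality`, which asks for positivity on the whole interval of
integration. -/
theorem exists_ray_interval [BorelSpace W] (hg : IsEvenLogConcave g) (q : ℕ) {y : W}
    (hy : y ∈ ballSet g q) : ∃ R, 0 < R ∧ (∀ r ∈ Ioo 0 R, 0 < g (r • y)) ∧
      IntegrableOn (fun r : ℝ => g (r • y) * r ^ q) (Ioo 0 R) ∧
      g 0 / (q + 1) ≤ ∫ r in (0 : ℝ)..R, g (r • y) * r ^ q := by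
  have h0 := hg.zero_pos
  rcases eq_or_ne y 0 with rfl | hy0
  -- On the degenerate ray `y = 0` the integrand is `g 0 * r ^ q`, and the interval `(0, 1)` gives
  -- exactly the threshold `g 0 / (q + 1)`.
  · refine ⟨1, one_pos, by simpa using fun _ _ _ => h0, ?_, ?_⟩
    · simp only [smul_zero]
      exact (by fun_prop : Continuous fun r : ℝ => g 0 * r ^ q).integrableOn_Icc.mono_set
        Ioo_subset_Icc_self
    · simp only [smul_zero]
      rw [integral_const_mul_pow]
      simp
  · obtain ⟨R₀, hR₀, hs⟩ := hg.bounded_support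
    obtain ⟨δ, hδ, c, hc, hδc⟩ := hg.pos_near_zero
    have hy' := norm_pos_iff.2 hy0
    set P : Set ℝ := {r | 0 < r ∧ 0 < g (r • y)} with hP
    have hb : ∀ r ∈ P, r ≤ R₀ / ‖y‖ := fun r hr => by
      by_contra hcon
      have := hr.2
      rw [hg.ray_eq_zero hs hy0 hR₀ r (not_le.1 hcon)] at this
      exact lt_irrefl _ this
    have hne : δ / ‖y‖ ∈ P := by
      refine ⟨by positivity, hc.trans_le (hδc _ ?_)⟩
      rw [norm_smul, Real.norm_of_nonneg (by positivity), div_mul_cancel₀ _ hy'.ne']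
    have hl := isLUB_csSup ⟨_, hne⟩ ⟨_, hb⟩
    have hR : 0 < sSup P := hne.1.trans_le (hl.1 hne)
    refine ⟨sSup P, hR, fun r hr => ?_, (hg.integrableOn_ray hy0 q).mono_set
      Ioo_subset_Ioi_self, ?_⟩
    · obtain ⟨p, hp, hrp⟩ := (lt_isLUB_iff hl).1 hr.2
      have := hg.le_smul (p • y) (t := r / p) (div_pos hr.1 hp.1) ((div_lt_one hp.1).2 hrp)
      rw [smul_smul, div_mul_cancel₀ _ hp.1.ne'] at this
      exact hp.2.trans_le this
    · have h1 : ENNReal.ofReal (g 0 / (q + 1)) ≤ rayMoment g q y := hy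
      rw [hg.rayMoment_eq hy0, ENNReal.ofReal_le_ofReal_iff'] at h1
      have h2 := h1.resolve_right (not_le.2 (by positivity))
      rw [intervalIntegral.integral_of_le hR.le]
      refine h2.trans (le_of_eq (setIntegral_eq_of_subset_of_forall_sdiff_eq_zero
        measurableSet_Ioi Ioc_subset_Ioi_self fun r hr => ?_))
      have h3 : g (r • y) = 0 := by
        by_contra hcon
        have : r ∈ P := ⟨hr.1, lt_of_le_of_ne (hg.nonneg _) (Ne.symm hcon)⟩
        exact hr.2 ⟨hr.1, hl.1 this⟩
      simp [h3]

theorem convex_ballSet [BorelSpace W] (hg : IsEvenLogConcave g) (q : ℕ) :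
    Convex ℝ (ballSet g q) := by
  refine convex_iff_forall_pos.2 fun y hy z hz a b ha hb hab => ?_
  obtain ⟨R, hR, hpR, hiR, hAR⟩ := hg.exists_ray_interval q hy
  obtain ⟨S, hS, hpS, hiS, hAS⟩ := hg.exists_ray_interval q hz
  have h0 := hg.zero_pos
  -- With `w` the harmonic mean of `r` and `s`, the point `w • (a • y + b • z)` is the convex
  -- combination of `r • y` and `s • z` with weights `a w / r` and `b w / s`.
  refine ball_inequality q ha hb hab hR hS (by positivity) hpR hpS (hg.continuousOn_ray hpR)
    (hg.continuousOn_ray hpS) hiR hiS hAR hAS fun r hr s hs w hw => ?_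
  have hr0 := hr.1
  have hs0 := hs.1
  have hw0 : 0 < w := by rw [hw]; positivity
  have hsum : a * w / r + b * w / s = 1 := by
    have : a * w / r + b * w / s = w * (a / r + b / s) := by ring
    rw [this, hw, inv_mul_cancel₀ (by positivity)]
  have := hg.logConcave _ _ (by positivity : 0 < a * w / r) (by positivity : 0 < b * w / s) hsum
    (r • y) (s • z)
  rw [smul_smul, smul_smul, div_mul_cancel₀ _ hr0.ne', div_mul_cancel₀ _ hs0.ne'] at this
  convert this using 2
  rw [smul_add, smul_smul, smul_smul, mul_comm w, mul_comm w]

theorem neg_mem_ballSet (hg : IsEvenLogConcave g) (q : ℕ) {y : W} (hy : y ∈ ballSet g q) :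
    -y ∈ ballSet g q := by
  have : rayMoment g q (-y) = rayMoment g q y := by
    simp only [rayMoment, smul_neg, hg.neg]
  simpa only [ballSet, mem_ofPred_eq, this] using hy

theorem ballSet_subset_closedBall (hg : IsEvenLogConcave g) (q : ℕ) :
    ∃ R, ballSet g q ⊆ closedBall 0 R := by
  obtain ⟨R, hR, hs⟩ := hg.bounded_support
  have h0 := hg.zero_pos
  refine ⟨R, fun y hy => ?_⟩
  by_contra hcon
  have hlt : R < ‖y‖ := by simpa using hcon
  have hy' : 0 < ‖y‖ := hR.trans hlt
  have hy0 := norm_pos_iff.1 hy'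
  -- Since `g ≤ g 0` and the ray leaves the support at `R / ‖y‖`, the moment falls below the
  -- threshold once `‖y‖ > R`.
  have h1 : rayMoment g q y ≤ ENNReal.ofReal (g 0 * (R / ‖y‖) ^ (q + 1) / (q + 1)) := by
    rw [← lintegral_const_mul_pow h0.le (by positivity), rayMoment,
      ← lintegral_indicator measurableSet_Ioi, ← lintegral_indicator measurableSet_Ioc]
    refine lintegral_mono fun r => ?_
    by_cases hr : r ∈ Ioc 0 (R / ‖y‖)
    · rw [indicator_of_mem hr, indicator_of_mem (mem_Ioi.2 hr.1)]
      have := hr.1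
      gcongr
      exact hg.le_zero _
    · rw [indicator_of_notMem hr]
      by_cases hr0 : r ∈ Ioi (0 : ℝ)
      · have : R / ‖y‖ < r := by
          by_contra h
          exact hr ⟨hr0, not_lt.1 h⟩
        rw [indicator_of_mem hr0, hg.ray_eq_zero hs hy0 hR r this]
        simp
      · rw [indicator_of_notMem hr0]
  have h2 := le_trans (show ENNReal.ofReal (g 0 / (q + 1)) ≤ _ from hy) h1
  rw [ENNReal.ofReal_le_ofReal_iff (by positivity)] at h2
  have h3 : (R / ‖y‖) ^ (q + 1) < 1 :=
    pow_lt_one₀ (by positivity) ((div_lt_one hy').2 hlt) (by simp)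
  have h4 : g 0 * (R / ‖y‖) ^ (q + 1) / (q + 1) < g 0 / (q + 1) := by
    gcongr
    nlinarith
  linarith

theorem ball_subset_ballSet (hg : IsEvenLogConcave g) (q : ℕ) :
    ∃ ε, 0 < ε ∧ closedBall 0 ε ⊆ ballSet g q := by
  obtain ⟨δ, hδ, c, hc, hδc⟩ := hg.pos_near_zero
  have h0 := hg.zero_pos
  have hcg : c ≤ g 0 := hδc 0 (by simpa using hδ.le)
  -- For such `y` the bound `g ≥ c` holds along the ray up to `r = g 0 / c ≥ 1`, which already gives
  -- a moment of at least `g 0 / (q + 1)`.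
  refine ⟨δ * c / g 0, by positivity, fun y hy => ?_⟩
  have hy' : ‖y‖ ≤ δ * c / g 0 := by simpa using hy
  have hM : 1 ≤ g 0 / c := (one_le_div hc).2 hcg
  calc ENNReal.ofReal (g 0 / (q + 1)) ≤ ENNReal.ofReal (c * (g 0 / c) ^ (q + 1) / (q + 1)) := by
        gcongr
        calc g 0 = c * (g 0 / c) := by field_simp
          _ ≤ c * (g 0 / c) ^ (q + 1) := by
            gcongr
            exact le_self_pow₀ hM (by simp)
    _ = ∫⁻ r in Ioc (0 : ℝ) (g 0 / c), ENNReal.ofReal (c * r ^ q) :=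
        (lintegral_const_mul_pow hc.le (by positivity) q).symm
    _ ≤ ∫⁻ r in Ioc (0 : ℝ) (g 0 / c), ENNReal.ofReal (g (r • y) * r ^ q) := by
        refine setLIntegral_mono_ae' measurableSet_Ioc (ae_of_all _ fun r hr => ?_)
        have := hr.1
        gcongr
        refine hδc _ ?_
        rw [norm_smul, Real.norm_of_nonneg hr.1.le]
        calc r * ‖y‖ ≤ g 0 / c * (δ * c / g 0) := by
              gcongr
              exact hr.2
          _ = δ := by field_simp
    _ ≤ _ := lintegral_mono_set Ioc_subset_Ioi_self

end IsEvenLogConcave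

/-! ### Second moments and volume of Ball's set. -/

/-- Both sides are compared after raising to the power `d + 2`. The constant is `54 = 6 * 3 ^ 2`,
from `(d + 2)! ≤ 6 d ^ 2 d!` and `d ^ d ≤ e ^ d d! ≤ 3 ^ d d!`. -/
theorem pow_factorial_bound (d : ℕ) (hd : 1 ≤ d) {x : ℝ} (hx : 0 ≤ x)
    (h : x ^ (d + 2) ≤ (d + 2).factorial) : x ^ d ≤ 54 * d.factorial := by
  have hf : (0 : ℝ) < d.factorial := by positivity
  by_contra hcon
  rw [not_le] at hcon
  have h1 : (54 * (d.factorial : ℝ)) ^ (d + 2) < (x ^ d) ^ (d + 2) :=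
    pow_lt_pow_left₀ hcon (by positivity) (by simp)
  have h2 : (x ^ d) ^ (d + 2) ≤ ((d + 2).factorial : ℝ) ^ d := by
    rw [← pow_mul, mul_comm, pow_mul]
    gcongr
  have hd1 : (1 : ℝ) ≤ d := by exact_mod_cast hd
  have h3 : ((d + 2).factorial : ℝ) ≤ 6 * (d : ℝ) ^ 2 * d.factorial := by
    rw [Nat.factorial_succ, Nat.factorial_succ]
    push_cast
    rw [← mul_assoc]
    refine mul_le_mul_of_nonneg_right ?_ hf.le
    nlinarith
  have h4 : (d : ℝ) ^ d ≤ 3 ^ d * d.factorial := by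
    have h5 := Real.pow_div_factorial_le_exp (d : ℝ) (by positivity) d
    rw [div_le_iff₀ hf] at h5
    refine h5.trans ?_
    gcongr
    rw [← mul_one (d : ℝ), Real.exp_nat_mul]
    gcongr
    exact Real.exp_one_lt_three.le
  have h6 : ((d + 2).factorial : ℝ) ^ d ≤ 54 ^ d * (d.factorial : ℝ) ^ (d + 2) :=
    calc ((d + 2).factorial : ℝ) ^ d ≤ (6 * (d : ℝ) ^ 2 * d.factorial) ^ d := by gcongr
      _ = 6 ^ d * ((d : ℝ) ^ d) ^ 2 * (d.factorial : ℝ) ^ d := by ring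
      _ ≤ 6 ^ d * (3 ^ d * (d.factorial : ℝ)) ^ 2 * (d.factorial : ℝ) ^ d := by gcongr
      _ = _ := by
          rw [show (54 : ℝ) = 6 * 3 ^ 2 by norm_num, mul_pow 6, ← pow_mul, mul_pow (3 ^ d),
            ← pow_mul, mul_comm 2 d]
          ring
  have h7 : (54 : ℝ) ^ d * (d.factorial : ℝ) ^ (d + 2) ≤ (54 * (d.factorial : ℝ)) ^ (d + 2) := by
    rw [mul_pow]
    gcongr
    · norm_num
    · simp
  linarith

namespace IsEvenLogConcave

variable {W : Type*} [NormedAddCommGroup W] [NormedSpace ℝ W] [MeasurableSpace W] [BorelSpace W]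
  {g : W → ℝ}

theorem integral_ray_pos (hg : IsEvenLogConcave g) {y : W} (hy : y ≠ 0) (q : ℕ) :
    0 < ∫ r in Ioi (0 : ℝ), g (r • y) * r ^ q := by
  obtain ⟨δ, hδ, c, hc, hδc⟩ := hg.pos_near_zero
  have hy' := norm_pos_iff.2 hy
  have hnn : ∀ r ∈ Ioi (0 : ℝ), 0 ≤ g (r • y) * r ^ q := fun r hr => by
    have : (0 : ℝ) < r := hr
    exact mul_nonneg (hg.nonneg _) (by positivity)
  have h1 : ∫ r in Ioc (0 : ℝ) (δ / ‖y‖), c * r ^ q ≤ ∫ r in Ioi (0 : ℝ), g (r • y) * r ^ q := by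
    refine le_trans (setIntegral_mono_on ?_ ((hg.integrableOn_ray hy q).mono_set
      Ioc_subset_Ioi_self) measurableSet_Ioc fun r hr => ?_)
      (setIntegral_mono_set (hg.integrableOn_ray hy q) ?_ Ioc_subset_Ioi_self.eventuallyLE)
    · exact (by fun_prop : Continuous fun r : ℝ => c * r ^ q).integrableOn_Icc.mono_set
        Ioc_subset_Icc_self
    · have := hr.1
      gcongr
      refine hδc _ ?_
      rw [norm_smul, Real.norm_of_nonneg hr.1.le, ← le_div_iff₀ hy']
      exact hr.2
    · filter_upwards [ae_restrict_mem measurableSet_Ioi] with r hr using hnn r hr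
  rw [← intervalIntegral.integral_of_le (by positivity), integral_const_mul_pow] at h1
  exact lt_of_lt_of_le (by positivity) h1

/-- The moment along `r • y` is the moment along `y` divided by `r ^ (q + 1)`, so the ray meets the
set in an interval with endpoint `ρ`. -/
theorem exists_radius (hg : IsEvenLogConcave g) (q : ℕ) {y : W} (hy : y ≠ 0) :
    ∃ ρ, 0 < ρ ∧ ρ ^ (q + 1) = (q + 1) * (∫ r in Ioi (0 : ℝ), g (r • y) * r ^ q) / g 0 ∧
      ∀ r, 0 < r → (r • y ∈ ballSet g q ↔ r ≤ ρ) := by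
  have h0 := hg.zero_pos
  set φ := ∫ r in Ioi (0 : ℝ), g (r • y) * r ^ q with hφ
  have hφ0 : 0 < φ := hg.integral_ray_pos hy q
  have hpos : 0 < (q + 1) * φ / g 0 := by positivity
  refine ⟨((q + 1) * φ / g 0) ^ ((q + 1 : ℕ) : ℝ)⁻¹, by positivity,
    Real.rpow_inv_natCast_pow hpos.le (by simp), fun r hr => ?_⟩
  have h1 : ∫ s in Ioi (0 : ℝ), g (s • r • y) * s ^ q = φ / r ^ (q + 1) := by
    have := integral_comp_mul_left_Ioi (fun s => g (s • y) * s ^ q) 0 hr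
    rw [mul_zero] at this
    have e : ∀ s : ℝ, g (s • r • y) * s ^ q = (r ^ q)⁻¹ * (g ((r * s) • y) * (r * s) ^ q) := by
      intro s
      rw [smul_smul, mul_comm s r, mul_pow]
      field_simp
    simp only [e]
    rw [integral_const_mul, this, smul_eq_mul, ← hφ, pow_succ]
    field_simp
  have h2 : r • y ≠ 0 := smul_ne_zero hr.ne' hy
  rw [ballSet, mem_ofPred_eq, hg.rayMoment_eq h2, h1, ENNReal.ofReal_le_ofReal_iff (by positivity),
    ← pow_le_pow_iff_left₀ hr.le (by positivity) (by simp : q + 1 ≠ 0),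
    Real.rpow_inv_natCast_pow hpos.le (by simp), div_le_div_iff₀ (by positivity) (by positivity),
    le_div_iff₀ h0, mul_comm (g 0), mul_comm φ]

variable [FiniteDimensional ℝ W]

theorem measurableSet_ballSet (hg : IsEvenLogConcave g) (q : ℕ) : MeasurableSet (ballSet g q) := by
  have := FiniteDimensional.proper ℝ W
  refine measurableSet_le measurable_const ?_
  refine Measurable.lintegral_prod_right' (f := fun z : W × ℝ =>
    ENNReal.ofReal (g (z.2 • z.1) * z.2 ^ q)) ?_
  exact ((hg.measurable.comp (continuous_snd.smul continuous_fst).measurable).mul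
    (measurable_snd.pow_const q)).ennreal_ofReal

variable [Nontrivial W]

/-- The order `q = d + 1` is chosen for this identity: in polar coordinates a 2-homogeneous function
contributes `ρ ^ (d + 2) / (d + 2)` in each direction, which is the moment of order `d + 1` of `g`
divided by `g 0`. -/
theorem setLIntegral_ballSet (hg : IsEvenLogConcave g) (μ : Measure W) [μ.IsAddHaarMeasure]
    {p : W → ENNReal} (hp : Measurable p)
    (hp2 : ∀ r : ℝ, 0 < r → ∀ y, p (r • y) = ENNReal.ofReal (r ^ 2) * p y) :
    ∫⁻ y in ballSet g (Module.finrank ℝ W + 1), p y ∂μ =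
      ENNReal.ofReal (g 0)⁻¹ * ∫⁻ y, ENNReal.ofReal (g y) * p y ∂μ := by
  have h0 := hg.zero_pos
  have hd : 0 < Module.finrank ℝ W := Module.finrank_pos
  set d := Module.finrank ℝ W with hdd
  have hB := hg.measurableSet_ballSet (d + 1)
  rw [← lintegral_indicator hB, lintegral_eq_lintegral_sphere μ (hp.indicator hB),
    lintegral_eq_lintegral_sphere μ (f := fun y => ENNReal.ofReal (g y) * p y)
      (hg.measurable.ennreal_ofReal.mul hp),
    ← lintegral_const_mul' _ _ ENNReal.ofReal_ne_top]
  refine lintegral_congr fun θ => ?_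
  have hθ : (θ : W) ≠ 0 := ne_zero_of_mem_unit_sphere θ
  obtain ⟨ρ, hρ, hρφ, hmem⟩ := hg.exists_radius (d + 1) hθ
  set φ := ∫ r in Ioi (0 : ℝ), g (r • (θ : W)) * r ^ (d + 1) with hφ
  have hpow : ∀ r : ℝ, r ^ (d - 1) * r ^ 2 = r ^ (d + 1) := fun r => by
    rw [← pow_add]; congr 1; omega
  have e1 : ∫⁻ r in Ioi (0 : ℝ), ENNReal.ofReal (r ^ (d - 1)) *
      (ballSet g (d + 1)).indicator p (r • (θ : W)) = p θ * ENNReal.ofReal (φ / g 0) := by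
    calc _ = ∫⁻ r in Ioc (0 : ℝ) ρ, p θ * ENNReal.ofReal (1 * r ^ (d + 1)) := by
          rw [← lintegral_indicator measurableSet_Ioi, ← lintegral_indicator measurableSet_Ioc]
          refine lintegral_congr fun r => ?_
          by_cases hr : 0 < r
          · rw [indicator_of_mem (mem_Ioi.2 hr)]
            by_cases hrρ : r ≤ ρ
            · rw [indicator_of_mem ((hmem r hr).2 hrρ), indicator_of_mem (s := Ioc 0 ρ) ⟨hr, hrρ⟩, hp2 r hr,
                one_mul, ← hpow, ENNReal.ofReal_mul (by positivity)]
              ring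
            · rw [indicator_of_notMem (fun h => hrρ ((hmem r hr).1 h)),
                indicator_of_notMem (s := Ioc 0 ρ) (fun h => hrρ h.2), mul_zero]
          · rw [indicator_of_notMem (s := Ioi 0) (fun h => hr h),
              indicator_of_notMem (s := Ioc 0 ρ) (fun h => hr h.1)]
      _ = _ := by
          rw [lintegral_const_mul _ (by fun_prop), lintegral_const_mul_pow zero_le_one hρ.le, hρφ]
          congr 2
          push_cast
          field_simp
  have e2 : ∫⁻ r in Ioi (0 : ℝ), ENNReal.ofReal (r ^ (d - 1)) *
      (ENNReal.ofReal (g (r • (θ : W))) * p (r • (θ : W))) = p θ * ENNReal.ofReal φ := by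
    rw [← hg.rayMoment_eq hθ, rayMoment, ← lintegral_const_mul (p (θ : W))
      (f := fun r : ℝ => ENNReal.ofReal (g (r • (θ : W)) * r ^ (d + 1)))
      ((hg.measurable_ray _).mul (measurable_id.pow_const _)).ennreal_ofReal]
    refine setLIntegral_congr_fun measurableSet_Ioi fun r hr => ?_
    have hr' : (0 : ℝ) < r := hr
    rw [hp2 r hr', ← hpow, ENNReal.ofReal_mul (hg.nonneg _), ENNReal.ofReal_mul (by positivity)]
    ring
  rw [e1, e2, div_eq_inv_mul, ENNReal.ofReal_mul (by positivity)]
  ring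

/-- In each direction the volume involves `ρ ^ d`, with `ρ` given by the moment of order `d + 1`,
whereas the mass of `g` involves the moment of order `d - 1`. `moment_comparison` bounds the former
moment by the latter. -/
theorem measure_ballSet_le (hg : IsEvenLogConcave g) (μ : Measure W) [μ.IsAddHaarMeasure] :
    μ (ballSet g (Module.finrank ℝ W + 1)) ≤
      ENNReal.ofReal (54 / g 0) * ∫⁻ y, ENNReal.ofReal (g y) ∂μ := by
  have h0 := hg.zero_pos
  have hd : 0 < Module.finrank ℝ W := Module.finrank_pos
  set d := Module.finrank ℝ W with hdd
  have hB := hg.measurableSet_ballSet (d + 1)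
  rw [← lintegral_indicator_one hB, lintegral_eq_lintegral_sphere μ (measurable_one.indicator hB),
    lintegral_eq_lintegral_sphere μ hg.measurable.ennreal_ofReal,
    ← lintegral_const_mul' _ _ ENNReal.ofReal_ne_top]
  refine lintegral_mono fun θ => ?_
  have hθ : (θ : W) ≠ 0 := ne_zero_of_mem_unit_sphere θ
  obtain ⟨ρ, hρ, hρφ, hmem⟩ := hg.exists_radius (d + 1) hθ
  obtain ⟨j, hj⟩ : ∃ j, d = j + 1 := ⟨d - 1, by omega⟩
  have hj' : d - 1 = j := by omega
  have e1 : ∫⁻ r in Ioi (0 : ℝ), ENNReal.ofReal (r ^ (d - 1)) *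
      (ballSet g (d + 1)).indicator 1 (r • (θ : W)) = ENNReal.ofReal (ρ ^ d / d) := by
    calc _ = ∫⁻ r in Ioc (0 : ℝ) ρ, ENNReal.ofReal (1 * r ^ j) := by
          rw [← lintegral_indicator measurableSet_Ioi, ← lintegral_indicator measurableSet_Ioc]
          refine lintegral_congr fun r => ?_
          by_cases hr : 0 < r
          · rw [indicator_of_mem (mem_Ioi.2 hr)]
            by_cases hrρ : r ≤ ρ
            · rw [indicator_of_mem ((hmem r hr).2 hrρ), indicator_of_mem (s := Ioc 0 ρ) ⟨hr, hrρ⟩, hj']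
              simp
            · rw [indicator_of_notMem (fun h => hrρ ((hmem r hr).1 h)),
                indicator_of_notMem (s := Ioc 0 ρ) (fun h => hrρ h.2), mul_zero]
          · rw [indicator_of_notMem (s := Ioi 0) (fun h => hr h),
              indicator_of_notMem (s := Ioc 0 ρ) (fun h => hr h.1)]
      _ = _ := by
          rw [lintegral_const_mul_pow zero_le_one hρ.le, one_mul, hj]
          push_cast
          rfl
  set I := ∫ r in Ioi (0 : ℝ), g (r • (θ : W)) * r ^ j with hI
  have hI0 : 0 < I := hg.integral_ray_pos hθ j
  have e2 : ∫⁻ r in Ioi (0 : ℝ), ENNReal.ofReal (r ^ (d - 1)) *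
      (ENNReal.ofReal (g (r • (θ : W)))) = ENNReal.ofReal I := by
    rw [← hg.rayMoment_eq hθ, rayMoment]
    refine setLIntegral_congr_fun measurableSet_Ioi fun r hr => ?_
    have hr' : (0 : ℝ) < r := hr
    rw [hj', ENNReal.ofReal_mul (hg.nonneg _), mul_comm]
  rw [e1, e2, ← ENNReal.ofReal_mul (by positivity)]
  refine ENNReal.ofReal_le_ofReal ?_
  -- Choose the exponential with the same moment of order `j`.
  set a := ((j.factorial : ℝ) * g 0 / I) ^ ((j + 1 : ℕ) : ℝ)⁻¹ with ha
  have hapos : 0 < (j.factorial : ℝ) * g 0 / I := by positivity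
  have ha0 : 0 < a := by positivity
  have hapow : a ^ (j + 1) = (j.factorial : ℝ) * g 0 / I :=
    Real.rpow_inv_natCast_pow hapos.le (by simp)
  obtain ⟨R, hR, hs⟩ := hg.bounded_support
  have eint : ∀ q : ℕ, ∫ r in Ioi (0 : ℝ), g (r • (θ : W)) / g 0 * r ^ q =
      (∫ r in Ioi (0 : ℝ), g (r • (θ : W)) * r ^ q) / g 0 := fun q => by
    rw [← integral_div]
    congr 1
    ext r
    ring
  have hmom := moment_comparison (f := fun r => g (r • (θ : W)) / g 0)
    ((hg.measurable_ray _).div_const _) (fun r => div_nonneg (hg.nonneg _) h0.le)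
    (fun r => div_le_one_of_le₀ (hg.le_zero _) h0.le)
    (R := R / ‖(θ : W)‖) (fun r hr => by simp only [hg.ray_eq_zero hs hθ hR r hr, zero_div])
    (fun r hr t ht ht1 => by
      rw [Real.div_rpow (hg.nonneg _) h0.le, div_le_div_iff₀ (by positivity) h0, mul_comm t r,
        mul_comm r t, ← smul_smul]
      have h2 := mul_le_mul_of_nonneg_right (hg.rpow_le_smul (r • (θ : W)) ht ht1)
        (Real.rpow_nonneg h0.le t)
      rwa [mul_assoc, ← Real.rpow_add h0, sub_add_cancel, Real.rpow_one] at h2)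
    j ha0 (by rw [eint, hapow]; field_simp; rfl)
  rw [eint] at hmom
  -- The comparison says that `ρ` is at most its value for the exponential, for which `(ρ * a) ^ (d
  -- + 2) = (d + 2)!`.
  have hx : (ρ * a) ^ (d + 2) ≤ (d + 2).factorial := by
    have e3 : ρ ^ (d + 2) = (d + 2) *
        ((∫ r in Ioi (0 : ℝ), g (r • (θ : W)) * r ^ (j + 2)) / g 0) := by
      rw [hρφ, hj]
      push_cast
      ring
    rw [mul_pow, e3]
    have h3 : (d + 2 : ℝ) * ((j + 2).factorial / a ^ (j + 3)) * a ^ (d + 2) = (d + 2).factorial := by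
      rw [hj, show j + 1 + 2 = (j + 2) + 1 by ring, Nat.factorial_succ (j + 2)]
      push_cast
      field_simp
      ring
    rw [← h3]
    gcongr
  have h4 := pow_factorial_bound d hd (by positivity) hx
  have h5 : (0 : ℝ) < d := by exact_mod_cast hd
  rw [mul_pow, hj, hapow, Nat.factorial_succ] at h4
  rw [hj]
  push_cast at h4 ⊢
  have h6 : (0 : ℝ) < j.factorial := by positivity
  rw [div_le_iff₀ (by positivity)]
  have h7 : ρ ^ (j + 1) * (j.factorial * g 0 / I) = ρ ^ (j + 1) * g 0 / I * j.factorial := by ring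
  rw [h7, ← mul_assoc, mul_le_mul_iff_left₀ h6, div_le_iff₀ hI0] at h4
  calc ρ ^ (j + 1) = ρ ^ (j + 1) * g 0 / g 0 := by field_simp
    _ ≤ 54 * (j + 1) * I / g 0 := by gcongr
    _ = _ := by ring

end IsEvenLogConcave

/-! ### Isotropic constants of convex bodies and of log-concave functions. -/

theorem LinearMap.det_adjoint_real {E : Type*} [NormedAddCommGroup E] [InnerProductSpace ℝ E]
    [FiniteDimensional ℝ E] (f : E →ₗ[ℝ] E) : LinearMap.det f.adjoint = LinearMap.det f := by
  let b := stdOrthonormalBasis ℝ E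
  rw [← LinearMap.det_toMatrix b.toBasis, ← LinearMap.det_toMatrix b.toBasis,
    LinearMap.toMatrix_adjoint, Matrix.det_conjTranspose]
  simp

/-- A linear map that scales all norms by `l` has `|det| = l ^ dim`. -/
theorem abs_det_of_norm_map {E : Type*} [NormedAddCommGroup E] [InnerProductSpace ℝ E]
    [FiniteDimensional ℝ E] (f : E →ₗ[ℝ] E) {l : ℝ} (hl : 0 ≤ l) (h : ∀ x, ‖f x‖ = l * ‖x‖) :
    |LinearMap.det f| = l ^ Module.finrank ℝ E := by
  -- The difference is symmetric and its quadratic form vanishes.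
  have e : f.adjoint ∘ₗ f = (l ^ 2) • LinearMap.id := by
    have hs : (f.adjoint ∘ₗ f - (l ^ 2) • LinearMap.id).IsSymmetric := by
      intro x y
      simp [LinearMap.adjoint_inner_left, LinearMap.adjoint_inner_right, inner_sub_left,
        inner_sub_right, inner_smul_left, inner_smul_right]
    rw [← sub_eq_zero, ← hs.inner_map_self_eq_zero]
    intro x
    simp only [LinearMap.sub_apply, LinearMap.comp_apply, LinearMap.smul_apply, LinearMap.id_apply,
      inner_sub_left, LinearMap.adjoint_inner_left, inner_smul_left]
    rw [real_inner_self_eq_norm_sq, real_inner_self_eq_norm_sq, h x]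
    simp
    ring
  have h2 := congrArg LinearMap.det e
  rw [LinearMap.det_comp, LinearMap.det_adjoint_real, LinearMap.det_smul, LinearMap.det_id,
    mul_one, ← pow_mul, mul_comm 2, pow_mul, ← sq] at h2
  rw [← abs_of_nonneg (pow_nonneg hl (Module.finrank ℝ E))]
  exact (sq_eq_sq_iff_abs_eq_abs _ _).1 h2

section

variable {n : ℕ}

local notation "𝔼" => EuclideanSpace ℝ (Fin n)

theorem setIntegral_linear_image (T : 𝔼 ≃ₗ[ℝ] 𝔼) {K : Set 𝔼} (hK : MeasurableSet K) (θ : 𝔼) :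
    ∫ x in T '' K, (inner ℝ x θ) ^ 2 =
      |LinearMap.det (T : 𝔼 →ₗ[ℝ] 𝔼)| * ∫ x in K, (inner ℝ (T x) θ) ^ 2 := by
  have := integral_image_eq_integral_abs_det_fderiv_smul volume hK
    (fun x _ => (T.toContinuousLinearEquiv.toContinuousLinearMap).hasFDerivWithinAt)
    T.injective.injOn (fun x => (inner ℝ x θ) ^ 2)
  simp only [smul_eq_mul] at this
  rw [integral_const_mul] at this
  exact this

theorem setIntegral_inner_sq_of_unit {K : Set 𝔼} {A : ℝ}
    (hA : ∀ θ : 𝔼, ‖θ‖ = 1 → ∫ x in K, (inner ℝ x θ) ^ 2 = A) (θ : 𝔼) :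
    ∫ x in K, (inner ℝ x θ) ^ 2 = A * ‖θ‖ ^ 2 := by
  rcases eq_or_ne θ 0 with rfl | hθ
  · simp
  · have h := hA (‖θ‖⁻¹ • θ) (norm_smul_inv_norm hθ)
    have h0 := norm_pos_iff.2 hθ
    simp only [inner_smul_right, mul_pow] at h
    rw [integral_const_mul] at h
    rw [← h]
    field_simp

theorem IsSymmConvexBody.measure_ne_top {K : Set 𝔼} (hK : IsSymmConvexBody K) :
    volume K ≠ ⊤ := hK.isCompact.measure_lt_top.ne

theorem IsSymmConvexBody.volume_real_pos {K : Set 𝔼} (hK : IsSymmConvexBody K) :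
    0 < (volume K).toReal :=
  ENNReal.toReal_pos (Measure.measure_pos_of_nonempty_interior _ hK.interior_nonempty).ne'
    hK.measure_ne_top

theorem IsSymmConvexBody.zero_mem_interior {K : Set 𝔼} (hK : IsSymmConvexBody K) :
    0 ∈ interior K := by
  obtain ⟨x, hx⟩ := hK.interior_nonempty
  have hneg : -x ∈ interior K := by
    have e : -K = K := by
      ext y
      exact ⟨fun h => by simpa using hK.neg_mem _ h, fun h => hK.neg_mem _ h⟩
    have h2 : -interior K = interior K := by
      have := (Homeomorph.neg 𝔼).preimage_interior K
      simp only [Homeomorph.coe_neg] at this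
      change -interior K = interior (-K) at this
      rw [this, e]
    rw [← h2]
    simpa using hx
  have := hK.convex.interior hx hneg (by norm_num : (0 : ℝ) ≤ 1 / 2) (by norm_num : (0 : ℝ) ≤ 1 / 2)
    (by norm_num)
  simpa using this

theorem IsSymmConvexBody.integral_pos {K : Set 𝔼} (hK : IsSymmConvexBody K) {θ : 𝔼}
    (hθ : ‖θ‖ = 1) : 0 < ∫ x in K, (inner ℝ x θ) ^ 2 := by
  have hc : Continuous fun x : 𝔼 => (inner ℝ x θ) ^ 2 := by fun_prop
  rw [setIntegral_pos_iff_support_of_nonneg_ae (ae_of_all _ fun x => sq_nonneg _)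
    (hc.continuousOn.integrableOn_compact hK.isCompact)]
  obtain ⟨ε, hε, hb⟩ := Metric.isOpen_iff.1 isOpen_interior 0 hK.zero_mem_interior
  have hopen : IsOpen (Function.support (fun x : 𝔼 => (inner ℝ x θ) ^ 2) ∩ interior K) :=
    hc.isOpen_support.inter isOpen_interior
  refine (hopen.measure_pos volume ⟨(ε / 2) • θ, ?_, hb ?_⟩).trans_le
    (measure_mono (inter_subset_inter_right _ interior_subset))
  · rw [Function.mem_support, inner_smul_left, real_inner_self_eq_norm_sq, hθ]
    simpa using hε.ne'
  · rw [mem_ball_zero_iff, norm_smul, hθ, Real.norm_of_nonneg (by positivity)]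
    linarith

/-- The isotropic constant of a body in isotropic position of arbitrary volume. -/
theorem isotropicConstant_eq (hn : 0 < n) {K : Set 𝔼} (hK : IsSymmConvexBody K) {A : ℝ}
    (hA : ∀ θ : 𝔼, ‖θ‖ = 1 → ∫ x in K, (inner ℝ x θ) ^ 2 = A) :
    isotropicConstant K = √(A / (volume K).toReal ^ (1 + 2 / n : ℝ)) := by
  have hn' : (n : ℝ) ≠ 0 := by positivity
  have : Nonempty (Fin n) := ⟨⟨0, hn⟩⟩
  set V := (volume K).toReal with hV
  have hV0 : 0 < V := hK.volume_real_pos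
  have hKV : volume K = ENNReal.ofReal V := (ENNReal.ofReal_toReal hK.measure_ne_top).symm
  obtain ⟨θ₀, hθ₀⟩ : ∃ θ : 𝔼, ‖θ‖ = 1 := exists_norm_eq _ zero_le_one
  have hA0 : 0 < A := hA θ₀ hθ₀ ▸ hK.integral_pos hθ₀
  have key : {c : ℝ | 0 ≤ c ∧ ∃ T : 𝔼 ≃ₗ[ℝ] 𝔼, volume (T '' K) = 1 ∧
      ∀ θ : 𝔼, ‖θ‖ = 1 → ∫ x in T '' K, (inner ℝ x θ) ^ 2 = c ^ 2} =
      {√(A / V ^ (1 + 2 / n : ℝ))} := by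
    refine Set.Subset.antisymm ?_ ?_
    · rintro c ⟨hc, T, hT1, hT2⟩
      set δ := |LinearMap.det (T : 𝔼 →ₗ[ℝ] 𝔼)| with hδ
      have h1 : δ * V = 1 := by
        have h2 := Measure.addHaar_image_linearMap volume (T : 𝔼 →ₗ[ℝ] 𝔼) K
        have h3 : volume (T '' K) = ENNReal.ofReal δ * volume K := h2
        rw [hT1, hKV, ← ENNReal.ofReal_mul (abs_nonneg _)] at h3
        have h4 := congrArg ENNReal.toReal h3
        rw [ENNReal.toReal_ofReal (by positivity)] at h4
        simpa using h4.symm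
      -- Isotropy of both `K` and `T '' K` forces the adjoint of `T` to scale all norms by one
      -- factor `l`. Volume one then gives `l = V ^ (-1 / n)`, which determines `c`.
      have h2 : ∀ θ : 𝔼, c ^ 2 * ‖θ‖ ^ 2 = δ * A * ‖LinearMap.adjoint (T : 𝔼 →ₗ[ℝ] 𝔼) θ‖ ^ 2 := by
        intro θ
        rw [← setIntegral_inner_sq_of_unit hT2, setIntegral_linear_image T hK.isCompact.measurableSet,
          mul_assoc, ← setIntegral_inner_sq_of_unit hA]
        simp only [LinearMap.adjoint_inner_right]
        rfl
      have hδ0 : 0 < δ := by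
        by_contra h
        have : δ = 0 := le_antisymm (not_lt.1 h) (abs_nonneg _)
        simp [this] at h1
      set l := c / √(δ * A) with hl
      have hl0 : 0 ≤ l := by positivity
      have h3 : ∀ θ : 𝔼, ‖LinearMap.adjoint (T : 𝔼 →ₗ[ℝ] 𝔼) θ‖ = l * ‖θ‖ := by
        intro θ
        rw [← sq_eq_sq₀ (norm_nonneg _) (by positivity), mul_pow, hl, div_pow,
          Real.sq_sqrt (by positivity), div_mul_eq_mul_div, h2]
        field_simp
      have h4 := abs_det_of_norm_map _ hl0 h3
      rw [LinearMap.det_adjoint_real, ← hδ, finrank_euclideanSpace_fin] at h4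
      have hδV : δ = V⁻¹ := eq_inv_of_mul_eq_one_left h1
      have h5 : l = V ^ (-(1 / n : ℝ)) := by
        have := Real.pow_rpow_inv_natCast hl0 hn.ne'
        rw [← this, ← h4, hδV, Real.rpow_neg hV0.le, Real.inv_rpow hV0.le, one_div]
      have h6 : c ^ 2 = A / V ^ (1 + 2 / n : ℝ) := by
        have h7 : l ^ 2 = c ^ 2 / (δ * A) := by
          rw [hl, div_pow, Real.sq_sqrt (by positivity)]
        have h8 : l ^ 2 = (V ^ (2 / n : ℝ))⁻¹ := by
          rw [h5, ← Real.rpow_natCast, ← Real.rpow_mul hV0.le, ← Real.rpow_neg hV0.le]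
          congr 1
          push_cast
          ring
        rw [h8, hδV] at h7
        rw [Real.rpow_add hV0, Real.rpow_one]
        field_simp at h7 ⊢
        linarith
      rw [mem_singleton_iff, ← h6, Real.sqrt_sq hc]
    -- Conversely, the dilation by `V ^ (-1 / n)` realises this value.
    · rintro _ rfl
      set t := V ^ (-(1 / n : ℝ)) with ht
      have ht0 : 0 < t := by positivity
      have htn : t ^ n = V⁻¹ := by
        rw [ht, ← Real.rpow_natCast, ← Real.rpow_mul hV0.le, ← Real.rpow_neg_one]
        congr 1
        field_simp
      have ht2 : t ^ 2 = (V ^ (2 / n : ℝ))⁻¹ := by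
        rw [ht, ← Real.rpow_natCast, ← Real.rpow_mul hV0.le, ← Real.rpow_neg hV0.le]
        congr 1
        push_cast
        ring
      have hdet : |LinearMap.det ((LinearEquiv.smulOfNeZero ℝ 𝔼 t ht0.ne' : 𝔼 ≃ₗ[ℝ] 𝔼) :
          𝔼 →ₗ[ℝ] 𝔼)| = V⁻¹ := by
        rw [abs_det_of_norm_map _ ht0.le, finrank_euclideanSpace_fin, htn]
        intro x
        simp [norm_smul, abs_of_pos ht0]
      refine ⟨Real.sqrt_nonneg _, LinearEquiv.smulOfNeZero ℝ 𝔼 t ht0.ne', ?_, fun θ hθ => ?_⟩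
      · have h2 := Measure.addHaar_image_linearMap volume
          ((LinearEquiv.smulOfNeZero ℝ 𝔼 t ht0.ne' : 𝔼 ≃ₗ[ℝ] 𝔼) : 𝔼 →ₗ[ℝ] 𝔼) K
        rw [hdet, hKV, ← ENNReal.ofReal_mul (by positivity), inv_mul_cancel₀ hV0.ne',
          ENNReal.ofReal_one] at h2
        exact h2
      · rw [setIntegral_linear_image _ hK.isCompact.measurableSet, hdet,
          Real.sq_sqrt (by positivity)]
        simp only [LinearEquiv.smulOfNeZero_apply, inner_smul_left, mul_pow]
        rw [integral_const_mul, hA θ hθ, Real.rpow_add hV0, Real.rpow_one]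
        simp only [conj_trivial, ht2]
        field_simp
  rw [isotropicConstant, key, csSup_singleton]

/-- A symmetric convex set of volume one in isotropic position contains a ball whose radius is its
isotropic constant. -/
theorem ball_subset_of_isotropic {K : Set 𝔼} (hK : IsCompact K) (hc : Convex ℝ K)
    (hneg : ∀ x ∈ K, -x ∈ K) (h1 : volume K = 1) {c : ℝ}
    (hA : ∀ θ : 𝔼, ‖θ‖ = 1 → ∫ x in K, (inner ℝ x θ) ^ 2 = c ^ 2) :
    ball 0 c ⊆ K := by
  intro x hx
  by_contra hxK
  -- If a point of norm less than `c` is missing, `K` lies in a slab `|⟨y, w⟩| < u` with `u < c *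
  -- ‖w‖`, too thin for the second moment `c ^ 2 * ‖w‖ ^ 2`.
  obtain ⟨f, u, hf, hfx⟩ := geometric_hahn_banach_closed_point hc hK.isClosed hxK
  set w := (InnerProductSpace.toDual ℝ 𝔼).symm f with hw
  have hfw : ∀ y, f y = inner ℝ y w := fun y => by
    rw [real_inner_comm, hw, InnerProductSpace.toDual_symm_apply]
  have hKne : K.Nonempty := by
    rw [nonempty_iff_ne_empty]
    rintro rfl
    simp at h1
  obtain ⟨y₀, hy₀⟩ := hKne
  have hu : 0 < u := by
    have h2 := hf _ hy₀
    have h3 := hf _ (hneg _ hy₀)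
    rw [map_neg] at h3
    linarith
  have hwx : u < ‖x‖ * ‖w‖ := hfx.trans_le (by rw [hfw]; exact real_inner_le_norm x w)
  have hw0 : 0 < ‖w‖ := by
    by_contra h
    have : ‖w‖ = 0 := le_antisymm (not_lt.1 h) (norm_nonneg _)
    rw [this, mul_zero] at hwx
    linarith
  have hxc : ‖x‖ < c := by simpa using hx
  have hI := setIntegral_inner_sq_of_unit hA w
  have hle : ∫ y in K, (inner ℝ y w) ^ 2 ≤ ∫ y in K, u ^ 2 := by
    refine setIntegral_mono_on ?_ ?_ hK.measurableSet fun y hy => ?_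
    · exact (by fun_prop : Continuous fun y : 𝔼 => (inner ℝ y w) ^ 2).continuousOn.integrableOn_compact hK
    · exact continuousOn_const.integrableOn_compact hK
    · have h2 := hf _ hy
      have h3 := hf _ (hneg _ hy)
      rw [map_neg] at h3
      rw [← hfw]
      exact sq_le_sq' (by linarith) h2.le
  rw [setIntegral_const, measureReal_def, h1, hI] at hle
  simp only [ENNReal.toReal_one, smul_eq_mul, one_mul, ← mul_pow] at hle
  have h4 : u < c * ‖w‖ := hwx.trans (by gcongr)
  have := pow_lt_pow_left₀ h4 hu.le two_ne_zero
  linarith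

/-- A body of volume one contains a ball of radius `c`, so `c ^ n * ω ≤ 1`. Without boundedness the
real supremum would default to 0 and bound nothing. -/
theorem bddAbove_isotropicConstant (hn : 0 < n) :
    BddAbove {c : ℝ | ∃ K : Set 𝔼, IsSymmConvexBody K ∧ c = isotropicConstant K} := by
  have : Nonempty (Fin n) := ⟨⟨0, hn⟩⟩
  set ω := (volume (ball (0 : 𝔼) 1)).toReal with hω
  have hω0 : 0 < ω := ENNReal.toReal_pos (measure_ball_pos _ _ one_pos).ne' measure_ball_lt_top.ne
  refine ⟨1 + ω⁻¹, ?_⟩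
  rintro _ ⟨K, hK, rfl⟩
  refine Real.sSup_le ?_ (by positivity)
  rintro c ⟨hc, T, hT1, hT2⟩
  have hsub := ball_subset_of_isotropic (K := T '' K)
    (hK.isCompact.image T.toContinuousLinearEquiv.continuous)
    (hK.convex.linear_image (T : 𝔼 →ₗ[ℝ] 𝔼)) (by
      rintro _ ⟨x, hx, rfl⟩
      exact ⟨-x, hK.neg_mem x hx, by simp⟩) hT1 hT2
  have h1 := measure_mono (μ := volume) hsub
  rw [hT1, Measure.addHaar_ball volume _ hc, finrank_euclideanSpace_fin] at h1
  have h2 := ENNReal.toReal_mono ENNReal.one_ne_top h1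
  rw [ENNReal.toReal_mul, ENNReal.toReal_ofReal (by positivity), ENNReal.toReal_one, ← hω] at h2
  rcases le_total c 1 with h | h
  · have : 0 < ω⁻¹ := by positivity
    linarith
  · have h3 : c ≤ c ^ n := le_self_pow₀ h hn.ne'
    have h4 : c ≤ ω⁻¹ := by
      rw [← one_div, le_div_iff₀ hω0]
      exact (mul_le_mul_of_nonneg_right h3 hω0.le).trans h2
    linarith

theorem isotropicConstant_le_max (hn : 0 < n) {K : Set 𝔼} (hK : IsSymmConvexBody K) :
    isotropicConstant K ≤ maxIsotropicConstant n :=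
  le_csSup (bddAbove_isotropicConstant hn) ⟨K, hK, rfl⟩

theorem IsEvenLogConcave.isSymmConvexBody_closure {g : 𝔼 → ℝ} (hg : IsEvenLogConcave g) (q : ℕ) :
    IsSymmConvexBody (closure (ballSet g q)) where
  isCompact := by
    obtain ⟨R, hR⟩ := hg.ballSet_subset_closedBall q
    exact (isBounded_closedBall.subset hR).isCompact_closure
  convex := (hg.convex_ballSet q).closure
  interior_nonempty := by
    obtain ⟨ε, hε, h⟩ := hg.ball_subset_ballSet q
    exact ⟨0, interior_mono ((h.trans subset_closure)) (by
      rw [interior_closedBall _ hε.ne']; simpa using hε)⟩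
  neg_mem := by
    intro x hx
    have : MapsTo (fun x : 𝔼 => -x) (ballSet g q) (ballSet g q) := fun x hx =>
      hg.neg_mem_ballSet q hx
    exact this.closure continuous_neg hx

/-- Comparison of an isotropic log-concave function with the isotropic constants of bodies. -/
theorem IsEvenLogConcave.le_maxIsotropicConstant (hn : 0 < n) {g : 𝔼 → ℝ}
    (hg : IsEvenLogConcave g) {A V : ℝ} (hV : 0 < V) (hA : 0 < A)
    (hgV : ∫⁻ y, ENNReal.ofReal (g y) = ENNReal.ofReal V)
    (hgA : ∀ θ : 𝔼, ‖θ‖ = 1 →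
      ∫⁻ y, ENNReal.ofReal (g y) * ENNReal.ofReal ((inner ℝ y θ) ^ 2) = ENNReal.ofReal A) :
    A * g 0 ^ (2 / n : ℝ) ≤ 54 ^ 3 * V ^ (1 + 2 / n : ℝ) * maxIsotropicConstant n ^ 2 := by
  have : Nonempty (Fin n) := ⟨⟨0, hn⟩⟩
  have h0 := hg.zero_pos
  set B := ballSet g (n + 1) with hB
  -- Bodies are compact, so the closure is used; the boundary of a convex set is null.
  have hae : closure B =ᵐ[volume] B := by
    refine (ae_eq_set.2 ⟨measure_mono_null ?_ ((hg.convex_ballSet (n + 1)).addHaar_frontier volume),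
      ?_⟩)
    · exact sdiff_subset_sdiff_right interior_subset
    · rw [sdiff_eq_empty.2 subset_closure, measure_empty]
  have hC := hg.isSymmConvexBody_closure (n + 1)
  have hiso : ∀ θ : 𝔼, ‖θ‖ = 1 → ∫ x in closure B, (inner ℝ x θ) ^ 2 = A / g 0 := by
    intro θ hθ
    rw [integral_eq_lintegral_of_nonneg_ae (ae_of_all _ fun x => sq_nonneg _)
      (by fun_prop : Continuous fun x : 𝔼 => (inner ℝ x θ) ^ 2).aestronglyMeasurable,
      Measure.restrict_congr_set hae]
    have := hg.setLIntegral_ballSet volume (p := fun y => ENNReal.ofReal ((inner ℝ y θ) ^ 2))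
      (by fun_prop) (fun r hr y => by
        rw [inner_smul_left, ← ENNReal.ofReal_mul (by positivity)]
        simp [mul_pow])
    rw [finrank_euclideanSpace_fin] at this
    rw [hB, this, hgA θ hθ, ← ENNReal.ofReal_mul (by positivity),
      ENNReal.toReal_ofReal (by positivity)]
    ring
  have hvol : (volume (closure B)).toReal ≤ 54 * V / g 0 := by
    have := hg.measure_ballSet_le volume
    rw [finrank_euclideanSpace_fin, hgV, ← ENNReal.ofReal_mul (by positivity)] at this
    rw [measure_congr hae]
    refine (ENNReal.toReal_mono ENNReal.ofReal_ne_top this).trans (le_of_eq ?_)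
    rw [ENNReal.toReal_ofReal (by positivity)]
    ring
  have hv0 := hC.volume_real_pos
  have hL := isotropicConstant_le_max hn hC
  rw [isotropicConstant_eq hn hC hiso] at hL
  set v := (volume (closure B)).toReal with hv
  have hn1 : (1 : ℝ) ≤ n := by exact_mod_cast hn
  have h2n : (2 / n : ℝ) ≤ 2 := by rw [div_le_iff₀ (by positivity)]; linarith
  have hL2 : A / g 0 / v ^ (1 + 2 / n : ℝ) ≤ maxIsotropicConstant n ^ 2 :=
    Real.sqrt_le_iff.1 hL |>.2
  -- The exponent `1 + 2 / n` is at most 3, hence `54 ^ 3`.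
  have hvp : v ^ (1 + 2 / n : ℝ) ≤ 54 ^ 3 * (V / g 0) ^ (1 + 2 / n : ℝ) := by
    calc v ^ (1 + 2 / n : ℝ) ≤ (54 * (V / g 0)) ^ (1 + 2 / n : ℝ) := by
          gcongr
          rwa [← mul_div_assoc]
      _ = 54 ^ (1 + 2 / n : ℝ) * (V / g 0) ^ (1 + 2 / n : ℝ) :=
          Real.mul_rpow (by norm_num) (by positivity)
      _ ≤ 54 ^ (3 : ℝ) * (V / g 0) ^ (1 + 2 / n : ℝ) := by
          gcongr
          · norm_num
          · linarith
      _ = _ := by norm_num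
  rw [div_le_iff₀ (by positivity)] at hL2
  have hgp : g 0 ^ (1 + 2 / n : ℝ) = g 0 * g 0 ^ (2 / n : ℝ) := by
    rw [Real.rpow_add h0, Real.rpow_one]
  have h3 : A / g 0 ≤ maxIsotropicConstant n ^ 2 * (54 ^ 3 * (V / g 0) ^ (1 + 2 / n : ℝ)) :=
    hL2.trans (by gcongr)
  rw [Real.div_rpow hV.le h0.le, hgp] at h3
  calc A * g 0 ^ (2 / n : ℝ) = A / g 0 * (g 0 * g 0 ^ (2 / n : ℝ)) := by field_simp
    _ ≤ maxIsotropicConstant n ^ 2 * (54 ^ 3 * (V ^ (1 + 2 / n : ℝ) / (g 0 * g 0 ^ (2 / n : ℝ)))) *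
        (g 0 * g 0 ^ (2 / n : ℝ)) := by gcongr
    _ = _ := by field_simp

end

/-! ### The Gamma function and volumes of Euclidean balls. -/

/-- Only the part `t > x` of the Gamma integral is kept, where `t ^ x ≥ x ^ x`. -/
theorem Real.rpow_div_exp_le_Gamma {x : ℝ} (hx : 0 < x) :
    (x / Real.exp 1) ^ x ≤ Real.Gamma (x + 1) := by
  rw [Real.Gamma_eq_integral (by positivity)]
  have hi : IntegrableOn (fun t : ℝ => Real.exp (-t) * t ^ (x + 1 - 1)) (Ioi 0) :=
    Real.GammaIntegral_convergent (by positivity)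
  calc (x / Real.exp 1) ^ x = ∫ t in Ioi x, Real.exp (-t) * x ^ x := by
        rw [integral_mul_const, integral_exp_neg_Ioi, Real.div_rpow hx.le (Real.exp_pos _).le,
          Real.exp_one_rpow, Real.exp_neg]
        field_simp
    _ ≤ ∫ t in Ioi x, Real.exp (-t) * t ^ (x + 1 - 1) := by
        refine setIntegral_mono_on ((integrableOn_exp_neg_Ioi x).mul_const _)
          (hi.mono_set (Ioi_subset_Ioi hx.le)) measurableSet_Ioi fun t ht => ?_
        rw [add_sub_cancel_right]
        gcongr
        exact (mem_Ioi.1 ht).le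
    _ ≤ _ := by
        refine setIntegral_mono_set hi ?_ (Ioi_subset_Ioi hx.le).eventuallyLE
        filter_upwards [ae_restrict_mem measurableSet_Ioi] with t ht
        have : (0 : ℝ) < t := ht
        positivity

/-- Log-convexity at the midpoint of `y` and `y + 1`. -/
theorem Real.Gamma_add_half_le {y : ℝ} (hy : 0 < y) :
    Real.Gamma (y + 1 / 2) ≤ √y * Real.Gamma y := by
  have h := Real.Gamma_mul_add_mul_le_rpow_Gamma_mul_rpow_Gamma (s := y) (t := y + 1)
    (a := 1 / 2) (b := 1 / 2) hy (by positivity) (by norm_num) (by norm_num) (by norm_num)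
  have hG := Real.Gamma_pos_of_pos hy
  rw [Real.Gamma_add_one hy.ne', ← Real.sqrt_eq_rpow, ← Real.sqrt_eq_rpow, Real.sqrt_mul hy.le,
    mul_left_comm, Real.mul_self_sqrt hG.le] at h
  convert h using 2
  ring

theorem Real.Gamma_half_add_le (m k : ℕ) :
    Real.Gamma (((m + k : ℕ) : ℝ) / 2 + 1) ≤
      √((m + k : ℕ) : ℝ) ^ k * Real.Gamma ((m : ℝ) / 2 + 1) := by
  induction k with
  | zero => simp
  | succ k ih =>
    have hG : 0 < Real.Gamma ((m : ℝ) / 2 + 1) := Real.Gamma_pos_of_pos (by positivity)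
    have h1 := Real.Gamma_add_half_le (y := ((m + k : ℕ) : ℝ) / 2 + 1) (by positivity)
    have e : ((m + (k + 1) : ℕ) : ℝ) / 2 + 1 = ((m + k : ℕ) : ℝ) / 2 + 1 + 1 / 2 := by
      push_cast; ring
    rw [e]
    have hk : (0 : ℝ) ≤ m := by positivity
    have hk' : (0 : ℝ) ≤ k := by positivity
    calc _ ≤ _ := h1
      _ ≤ √((m + (k + 1) : ℕ) : ℝ) *
          (√((m + (k + 1) : ℕ) : ℝ) ^ k * Real.Gamma ((m : ℝ) / 2 + 1)) := by
          gcongr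
          · push_cast; linarith
          · refine ih.trans ?_
            gcongr
            linarith
      _ = _ := by ring

/-- The volume of the unit ball in a Euclidean space of dimension `d`. -/
noncomputable def unitBallVolume (d : ℕ) : ℝ := √Real.pi ^ d / Real.Gamma ((d : ℝ) / 2 + 1)

theorem unitBallVolume_pos (d : ℕ) : 0 < unitBallVolume d := by
  have : 0 < Real.Gamma ((d : ℝ) / 2 + 1) := Real.Gamma_pos_of_pos (by positivity)
  have := Real.pi_pos
  unfold unitBallVolume
  positivity

theorem volume_unitBall {E : Type*} [NormedAddCommGroup E] [InnerProductSpace ℝ E]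
    [FiniteDimensional ℝ E] [MeasurableSpace E] [BorelSpace E] [Nontrivial E] :
    volume (ball (0 : E) 1) = ENNReal.ofReal (unitBallVolume (Module.finrank ℝ E)) := by
  rw [InnerProductSpace.volume_ball, unitBallVolume]
  simp

theorem unitBallVolume_rpow (m : ℕ) {n : ℕ} (hn : 0 < n) :
    unitBallVolume n ^ (m / n : ℝ) = √Real.pi ^ m / Real.Gamma ((n : ℝ) / 2 + 1) ^ (m / n : ℝ) := by
  have hG : 0 < Real.Gamma ((n : ℝ) / 2 + 1) := Real.Gamma_pos_of_pos (by positivity)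
  rw [unitBallVolume, Real.div_rpow (by positivity) hG.le, ← Real.rpow_natCast,
    ← Real.rpow_mul (by positivity), ← Real.rpow_natCast _ m]
  congr 2
  field_simp

/-- The powers of `π` agree on both sides; the rest is log-convexity of Gamma between `1` and `n / 2
+ 1`, with `Γ(1) = 1`. -/
theorem rpow_unitBallVolume_le {m n : ℕ} (hm : 0 < m) (hmn : m ≤ n) :
    unitBallVolume n ^ (m / n : ℝ) ≤ unitBallVolume m := by
  have hn : 0 < n := hm.trans_le hmn
  have hn' : (0 : ℝ) < n := by positivity
  have hm' : (0 : ℝ) < m := by positivity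
  have hG : 0 < Real.Gamma ((m : ℝ) / 2 + 1) := Real.Gamma_pos_of_pos (by positivity)
  have hG2 : 0 < Real.Gamma ((n : ℝ) / 2 + 1) := Real.Gamma_pos_of_pos (by positivity)
  rw [unitBallVolume_rpow m hn, unitBallVolume]
  gcongr
  have hmn' : (m / n : ℝ) ≤ 1 := by
    rw [div_le_one hn']; exact_mod_cast hmn
  have h := Real.convexOn_log_Gamma.2 (x := 1) (y := (n : ℝ) / 2 + 1) (by simp)
    (by simp only [mem_Ioi]; positivity) (sub_nonneg.2 hmn') (by positivity : (0 : ℝ) ≤ m / n)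
    (by ring)
  have e : (1 - (m / n : ℝ)) • (1 : ℝ) + (m / n : ℝ) • ((n : ℝ) / 2 + 1) = (m : ℝ) / 2 + 1 := by
    simp only [smul_eq_mul]
    field_simp
    ring
  rw [e] at h
  simp only [Function.comp_apply, Real.Gamma_one, Real.log_one, smul_eq_mul, mul_zero, zero_add] at h
  rw [← Real.log_le_log_iff hG (by positivity), Real.log_rpow hG2]
  exact h

/-- The 6 comes from `2 e < 6`. -/
theorem sqrt_div_six_pow_le {n : ℕ} (hn : 0 < n) (k : ℕ) :
    √(n / 6 : ℝ) ^ k ≤ Real.Gamma ((n : ℝ) / 2 + 1) ^ (k / n : ℝ) := by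
  have hn' : (0 : ℝ) < n := by positivity
  have h := Real.rpow_div_exp_le_Gamma (x := (n : ℝ) / 2) (by positivity)
  calc √(n / 6 : ℝ) ^ k = ((n / 6 : ℝ) ^ ((n : ℝ) / 2)) ^ (k / n : ℝ) := by
        rw [← Real.rpow_mul (by positivity), Real.sqrt_eq_rpow, ← Real.rpow_natCast,
          ← Real.rpow_mul (by positivity)]
        congr 1
        field_simp
    _ ≤ (((n : ℝ) / 2 / Real.exp 1) ^ ((n : ℝ) / 2)) ^ (k / n : ℝ) := by
        have : (n / 6 : ℝ) ≤ n / 2 / Real.exp 1 := by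
          rw [div_div]
          exact div_le_div_of_nonneg_left hn'.le (by positivity)
            (by linarith [Real.exp_one_lt_three])
        gcongr
    _ ≤ _ := by gcongr

/-- With `n = m + k` and `G = Γ(n / 2 + 1)`, write `G ^ (m / n) = G / G ^ (k / n)`. The numerator is
at most `√n ^ k * Γ(m / 2 + 1)`, the denominator at least `√(n / 6) ^ k`, and `√n` cancels. -/
theorem unitBallVolume_le_rpow {m k : ℕ} (hm : 0 < m) :
    unitBallVolume m ≤ √6 ^ k * unitBallVolume (m + k) ^ (m / (m + k : ℕ) : ℝ) := by
  have hG : 0 < Real.Gamma ((m : ℝ) / 2 + 1) := Real.Gamma_pos_of_pos (by positivity)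
  have hn : 0 < m + k := by omega
  have hn' : (0 : ℝ) < (m + k : ℕ) := by positivity
  have hG2 : 0 < Real.Gamma (((m + k : ℕ) : ℝ) / 2 + 1) := Real.Gamma_pos_of_pos (by positivity)
  rw [unitBallVolume_rpow m hn, unitBallVolume]
  set G := Real.Gamma (((m + k : ℕ) : ℝ) / 2 + 1) with hGd
  have h1 := Real.Gamma_half_add_le m k
  rw [← hGd] at h1
  have h2 := sqrt_div_six_pow_le hn k
  rw [← hGd] at h2
  have h3 : G ^ (m / (m + k : ℕ) : ℝ) * G ^ (k / (m + k : ℕ) : ℝ) = G := by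
    rw [← Real.rpow_add hG2, ← add_div, ← Nat.cast_add, div_self hn'.ne', Real.rpow_one]
  have h4 : G ^ (m / (m + k : ℕ) : ℝ) ≤ √6 ^ k * Real.Gamma ((m : ℝ) / 2 + 1) := by
    have h5 : G ^ (m / (m + k : ℕ) : ℝ) * √((m + k : ℕ) / 6 : ℝ) ^ k ≤
        √((m + k : ℕ) : ℝ) ^ k * Real.Gamma ((m : ℝ) / 2 + 1) := by
      refine le_trans ?_ h1
      conv_rhs => rw [← h3]
      gcongr
    rw [Real.sqrt_div hn'.le, div_pow, mul_div_assoc', div_le_iff₀ (by positivity)] at h5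
    have h6 : (0 : ℝ) < √((m + k : ℕ) : ℝ) ^ k := by positivity
    refine le_of_mul_le_mul_right ?_ h6
    linarith
  rw [mul_div_assoc', div_le_div_iff₀ hG (by positivity)]
  calc _ ≤ √Real.pi ^ m * (√6 ^ k * Real.Gamma ((m : ℝ) / 2 + 1)) := by gcongr
    _ = _ := by ring

theorem unitBallVolume_mul_sqrt_pow_le {k : ℕ} (hk : 0 < k) :
    unitBallVolume k * √(k : ℝ) ^ k ≤ √24 ^ k := by
  have hk' : (0 : ℝ) < k := by positivity
  have hG : 0 < Real.Gamma ((k : ℝ) / 2 + 1) := Real.Gamma_pos_of_pos (by positivity)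
  have h := sqrt_div_six_pow_le hk k
  rw [div_self hk'.ne', Real.rpow_one] at h
  rw [unitBallVolume, div_mul_eq_mul_div, div_le_iff₀ hG]
  calc √Real.pi ^ k * √(k : ℝ) ^ k ≤ √4 ^ k * √(k : ℝ) ^ k := by
        gcongr
        exact Real.pi_le_four
    _ = √24 ^ k * √(k / 6 : ℝ) ^ k := by
        rw [← mul_pow, ← mul_pow, ← Real.sqrt_mul (by norm_num), ← Real.sqrt_mul (by norm_num)]
        congr 2
        ring
    _ ≤ _ := by gcongr

/-! ### Volumes of parallel sections as an isotropic log-concave function. -/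

section Sections

variable {n k : ℕ} (E : Submodule ℝ (EuclideanSpace ℝ (Fin n)))
  (φ : EuclideanSpace ℝ (Fin k) ≃ₗᵢ[ℝ] Eᗮ) (K : Set (EuclideanSpace ℝ (Fin n)))

/-- The sections of `K` parallel to `E`, as a subset of the product. -/
def fiberSet : Set (E × EuclideanSpace ℝ (Fin k)) :=
  {z | (z.1 : EuclideanSpace ℝ (Fin n)) + φ z.2 ∈ K}

/-- The volume of the sections of `K` parallel to `E`. -/
noncomputable def sectionVolume (y : EuclideanSpace ℝ (Fin k)) : ℝ :=
  (volume {x : E | (x : EuclideanSpace ℝ (Fin n)) + φ y ∈ K}).toReal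

theorem norm_add_orthogonal_sq (x : E) (y : EuclideanSpace ℝ (Fin k)) :
    ‖(x : EuclideanSpace ℝ (Fin n)) + φ y‖ ^ 2 = ‖x‖ ^ 2 + ‖y‖ ^ 2 := by
  have h := norm_add_sq_eq_norm_sq_add_norm_sq_of_inner_eq_zero (x : EuclideanSpace ℝ (Fin n))
    (φ y : EuclideanSpace ℝ (Fin n)) (Submodule.inner_right_of_mem_orthogonal x.2 (φ y).2)
  have e : ‖(φ y : EuclideanSpace ℝ (Fin n))‖ = ‖y‖ := φ.norm_map y
  rw [sq, h, e, sq, sq, Submodule.coe_norm]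

theorem continuous_add_orthogonal :
    Continuous fun z : E × EuclideanSpace ℝ (Fin k) =>
      (z.1 : EuclideanSpace ℝ (Fin n)) + φ z.2 :=
  (continuous_subtype_val.comp continuous_fst).add
    (continuous_subtype_val.comp (φ.continuous.comp continuous_snd))

theorem measurePreserving_add_orthogonal :
    MeasurePreserving fun z : E × EuclideanSpace ℝ (Fin k) =>
      (z.1 : EuclideanSpace ℝ (Fin n)) + φ z.2 := by
  have h1 : MeasurePreserving (Prod.map id φ : E × EuclideanSpace ℝ (Fin k) → E × Eᗮ) :=
    (MeasurePreserving.id volume).prod φ.measurePreserving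
  have h2 := (E.orthogonalDecomposition.symm.measurePreserving.comp
    (WithLp.volume_preserving_toLp E Eᗮ)).comp h1
  convert h2 using 1
  ext1 z
  simp only [Function.comp_apply, Submodule.orthogonalDecomposition_symm_apply]
  rfl

variable {E φ K}

theorem convex_fiberSet (hK : Convex ℝ K) : Convex ℝ (fiberSet E φ K) := by
  intro z hz w hw a b ha hb hab
  have := hK hz hw ha hb hab
  simp only [fiberSet, mem_ofPred_eq] at this ⊢
  convert this using 1
  simp [smul_add]
  abel

theorem measurableSet_fiberSet (hK : IsClosed K) : MeasurableSet (fiberSet E φ K) :=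
  (hK.preimage (continuous_add_orthogonal E φ)).measurableSet

theorem volume_section_ne_top (hK : IsCompact K) (y : EuclideanSpace ℝ (Fin k)) :
    volume {x : E | (x : EuclideanSpace ℝ (Fin n)) + φ y ∈ K} ≠ ⊤ := by
  obtain ⟨R, hR⟩ := hK.isBounded.subset_closedBall 0
  refine ne_top_of_le_ne_top (measure_closedBall_lt_top (x := (0 : E)) (r := R)).ne
    (measure_mono fun x hx => ?_)
  have h1 : ‖(x : EuclideanSpace ℝ (Fin n)) + φ y‖ ≤ R := by simpa using hR hx
  have h2 := norm_add_orthogonal_sq E φ x y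
  rw [mem_closedBall_zero_iff]
  have h3 : ‖x‖ ^ 2 ≤ ‖(x : EuclideanSpace ℝ (Fin n)) + φ y‖ ^ 2 := by
    rw [h2]; nlinarith [sq_nonneg ‖y‖]
  exact (pow_le_pow_iff_left₀ (norm_nonneg _) (norm_nonneg _) two_ne_zero).1 h3 |>.trans h1

theorem isEvenLogConcave_sectionVolume (hK : IsSymmConvexBody K) :
    IsEvenLogConcave (sectionVolume E φ K) where
  measurable := by
    have := measurable_measure_prodMk_right (μ := (volume : Measure E))
      (measurableSet_fiberSet (E := E) (φ := φ) hK.isCompact.isClosed)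
    exact this.ennreal_toReal
  nonneg _ := ENNReal.toReal_nonneg
  neg y := by
    rw [sectionVolume, sectionVolume, ← Measure.measure_neg volume]
    congr 2
    ext x
    simp only [mem_neg, mem_ofPred_eq]
    constructor
    · intro h
      have := hK.neg_mem _ h
      simpa [add_comm] using this
    · intro h
      have := hK.neg_mem _ h
      simpa [add_comm] using this
  logConcave a b ha hb hab y z := by
    have := volume_section_logConcave (convex_fiberSet (E := E) (φ := φ) hK.convex) (fun y =>
      measurable_prodMk_right (measurableSet_fiberSet hK.isCompact.isClosed)) ha hb hab y z
    have h2 := ENNReal.toReal_mono (volume_section_ne_top hK.isCompact _) this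
    rwa [ENNReal.toReal_mul, ← ENNReal.toReal_rpow, ← ENNReal.toReal_rpow] at h2
  bounded_support := by
    obtain ⟨R, hR⟩ := hK.isCompact.isBounded.subset_closedBall 0
    refine ⟨max R 1, by positivity, fun y hy => ?_⟩
    have : {x : E | (x : EuclideanSpace ℝ (Fin n)) + φ y ∈ K} = ∅ := by
      refine eq_empty_of_forall_notMem fun x hx => ?_
      have h1 : ‖(x : EuclideanSpace ℝ (Fin n)) + φ y‖ ≤ R := by simpa using hR hx
      have h2 := norm_add_orthogonal_sq E φ x y
      have h3 : ‖y‖ ^ 2 ≤ ‖(x : EuclideanSpace ℝ (Fin n)) + φ y‖ ^ 2 := by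
        rw [h2]; nlinarith [sq_nonneg ‖x‖]
      have h4 := (pow_le_pow_iff_left₀ (norm_nonneg _) (norm_nonneg _) two_ne_zero).1 h3
      linarith [le_max_left R 1]
    simp [sectionVolume, this]
  pos_near_zero := by
    obtain ⟨ε, hε, hb⟩ := Metric.isOpen_iff.1 isOpen_interior 0 hK.zero_mem_interior
    refine ⟨ε / 3, by positivity, (volume (ball (0 : E) (ε / 3))).toReal,
      ENNReal.toReal_pos (measure_ball_pos _ _ (by positivity)).ne' measure_ball_lt_top.ne,
      fun y hy => ?_⟩
    refine ENNReal.toReal_mono (volume_section_ne_top hK.isCompact _) (measure_mono fun x hx => ?_)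
    refine (show (x : EuclideanSpace ℝ (Fin n)) + φ y ∈ K from interior_subset (hb ?_))
    have hx' : ‖x‖ < ε / 3 := by simpa using hx
    rw [mem_ball_zero_iff]
    calc _ ≤ ‖(x : EuclideanSpace ℝ (Fin n))‖ + ‖(φ y : EuclideanSpace ℝ (Fin n))‖ :=
          norm_add_le _ _
      _ = ‖x‖ + ‖y‖ := by rw [← φ.norm_map y]; rfl
      _ < ε := by linarith

/-- Fubini for the splitting into `E` and its complement, for weights that depend only on the
complement component. Mass and second moments of the marginal are the two cases needed. -/
theorem lintegral_sectionVolume (hK : IsCompact K) {p : EuclideanSpace ℝ (Fin k) → ENNReal}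
    (hp : Measurable p) {P : EuclideanSpace ℝ (Fin n) → ENNReal} (hP : Measurable P)
    (h : ∀ (x : E) y, P ((x : EuclideanSpace ℝ (Fin n)) + φ y) = p y) :
    ∫⁻ y, ENNReal.ofReal (sectionVolume E φ K y) * p y = ∫⁻ x in K, P x := by
  have hm := measurableSet_fiberSet (E := E) (φ := φ) hK.isClosed
  have mp := measurePreserving_add_orthogonal E φ
  rw [← mp.setLIntegral_comp_preimage hK.measurableSet hP]
  change _ = ∫⁻ z in fiberSet E φ K, _
  simp only [h]
  rw [← lintegral_indicator hm]
  change _ = ∫⁻ z, _ ∂(volume.prod volume)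
  rw [lintegral_prod_symm' ((fiberSet E φ K).indicator fun z => p z.2) ((hp.comp measurable_snd).indicator hm)]
  refine lintegral_congr fun y => ?_
  rw [sectionVolume, ENNReal.ofReal_toReal (volume_section_ne_top hK y), mul_comm]
  have hs : MeasurableSet {x : E | (x : EuclideanSpace ℝ (Fin n)) + φ y ∈ K} :=
    measurable_prodMk_right hm
  rw [← setLIntegral_const, ← lintegral_indicator hs]
  rfl

theorem lintegral_sectionVolume_eq (hK : IsCompact K) :
    ∫⁻ y, ENNReal.ofReal (sectionVolume E φ K y) = volume K := by
  have := lintegral_sectionVolume (E := E) (φ := φ) hK (p := fun _ => 1) measurable_const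
    (P := fun _ => 1) measurable_const (fun _ _ => rfl)
  simpa using this

theorem lintegral_sectionVolume_inner_sq (hK : IsCompact K) {A : ℝ}
    (hA : ∀ θ : EuclideanSpace ℝ (Fin n), ‖θ‖ = 1 → ∫ x in K, (inner ℝ x θ) ^ 2 = A)
    {θ : EuclideanSpace ℝ (Fin k)} (hθ : ‖θ‖ = 1) :
    ∫⁻ y, ENNReal.ofReal (sectionVolume E φ K y) * ENNReal.ofReal ((inner ℝ y θ) ^ 2) =
      ENNReal.ofReal A := by
  have hnorm : ‖(φ θ : EuclideanSpace ℝ (Fin n))‖ = 1 := by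
    rw [← hθ, ← φ.norm_map θ]; rfl
  rw [← hA _ hnorm, ofReal_integral_eq_lintegral_ofReal
    ((by fun_prop : Continuous fun x : EuclideanSpace ℝ (Fin n) =>
      (inner ℝ x (φ θ : EuclideanSpace ℝ (Fin n))) ^ 2).continuousOn.integrableOn_compact hK)
    (ae_of_all _ fun x => sq_nonneg _)]
  refine lintegral_sectionVolume hK (by fun_prop) (by fun_prop) fun x y => ?_
  have e : inner ℝ ((φ y : Eᗮ) : EuclideanSpace ℝ (Fin n)) (φ θ : EuclideanSpace ℝ (Fin n)) =
      inner ℝ y θ := by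
    rw [← φ.inner_map_map y θ]; rfl
  rw [inner_add_left, Submodule.inner_right_of_mem_orthogonal x.2 (φ θ).2, zero_add, e]

end Sections

/-- Lower bound for the maximum of an isotropic log-concave function. -/
theorem IsEvenLogConcave.volume_le {k : ℕ} (hk : 0 < k) {g : EuclideanSpace ℝ (Fin k) → ℝ}
    (hg : IsEvenLogConcave g) {A V : ℝ} (hV : 0 < V) (hA : 0 < A)
    (hgV : ∫⁻ y, ENNReal.ofReal (g y) = ENNReal.ofReal V)
    (hgA : ∀ θ : EuclideanSpace ℝ (Fin k), ‖θ‖ = 1 →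
      ∫⁻ y, ENNReal.ofReal (g y) * ENNReal.ofReal ((inner ℝ y θ) ^ 2) = ENNReal.ofReal A) :
    V ≤ 2 * unitBallVolume k * g 0 * √(2 * k * A / V) ^ k := by
  have : Nonempty (Fin k) := ⟨⟨0, hk⟩⟩
  have hk' : (0 : ℝ) < k := by positivity
  have h0 := hg.zero_pos
  -- With this radius Chebyshev leaves at most `k A / t ^ 2 = V / 2` of the mass outside the ball.
  set t := √(2 * k * A / V) with ht
  have ht0 : 0 < t := by positivity
  have hω := unitBallVolume_pos k
  have hball : volume (ball (0 : EuclideanSpace ℝ (Fin k)) t) =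
      ENNReal.ofReal (t ^ k * unitBallVolume k) := by
    rw [Measure.addHaar_ball volume _ ht0.le, volume_unitBall, finrank_euclideanSpace_fin,
      ← ENNReal.ofReal_mul (by positivity)]
  have hsum : ∫⁻ y, ENNReal.ofReal (g y) * ENNReal.ofReal (‖y‖ ^ 2) = ENNReal.ofReal (k * A) := by
    have e : ∀ y : EuclideanSpace ℝ (Fin k), ENNReal.ofReal (g y) * ENNReal.ofReal (‖y‖ ^ 2) =
        ∑ i, ENNReal.ofReal (g y) *
          ENNReal.ofReal ((inner ℝ y (EuclideanSpace.single i (1 : ℝ))) ^ 2) := by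
      intro y
      rw [← Finset.mul_sum, ← ENNReal.ofReal_sum_of_nonneg (fun i _ => sq_nonneg _),
        EuclideanSpace.norm_sq_eq]
      simp [EuclideanSpace.inner_single_right]
    simp only [e]
    rw [lintegral_finsetSum Finset.univ (f := fun i y => ENNReal.ofReal (g y) *
      ENNReal.ofReal ((inner ℝ y (EuclideanSpace.single i (1 : ℝ))) ^ 2))
      (fun i _ => hg.measurable.ennreal_ofReal.mul (by fun_prop))]
    rw [Finset.sum_congr rfl fun i _ => hgA _ (by simp)]
    rw [Finset.sum_const, Finset.card_univ, Fintype.card_fin, nsmul_eq_mul,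
      ENNReal.ofReal_mul hk'.le, ENNReal.ofReal_natCast]
  have hle : ENNReal.ofReal V ≤ ENNReal.ofReal (g 0) * ENNReal.ofReal (t ^ k * unitBallVolume k) +
      ENNReal.ofReal (t ^ 2)⁻¹ * ENNReal.ofReal (k * A) := by
    rw [← hgV, ← hsum, ← lintegral_add_compl _ (measurableSet_ball (x := 0) (ε := t)), ← hball,
      ← setLIntegral_const, ← lintegral_const_mul' _ _ ENNReal.ofReal_ne_top]
    refine add_le_add (setLIntegral_mono_ae' measurableSet_ball (ae_of_all _ fun y _ =>
      ENNReal.ofReal_le_ofReal (hg.le_zero _))) ?_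
    · refine le_trans ?_ (setLIntegral_le_lintegral (ball (0 : EuclideanSpace ℝ (Fin k)) t)ᶜ _)
      refine setLIntegral_mono_ae' measurableSet_ball.compl (ae_of_all _ fun y hy => ?_)
      have hy' : t ≤ ‖y‖ := by simpa using hy
      rw [← ENNReal.ofReal_mul (hg.nonneg _), ← ENNReal.ofReal_mul (by positivity)]
      refine ENNReal.ofReal_le_ofReal ?_
      rw [inv_mul_eq_div, le_div_iff₀ (by positivity)]
      exact mul_le_mul_of_nonneg_left (by gcongr) (hg.nonneg _)
  rw [← ENNReal.ofReal_mul h0.le, ← ENNReal.ofReal_mul (by positivity),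
    ← ENNReal.ofReal_add (by positivity) (by positivity),
    ENNReal.ofReal_le_ofReal_iff (by positivity)] at hle
  have h2 : (t ^ 2)⁻¹ * (k * A) = V / 2 := by
    rw [ht, Real.sq_sqrt (by positivity)]
    field_simp
  rw [h2] at hle
  linarith

/-! ### Radial functions and the spherical Radon transform. -/

section

variable {n : ℕ}

local notation "𝔼" => EuclideanSpace ℝ (Fin n)

theorem IsSymmConvexBody.gauge_pos {K : Set 𝔼} (hK : IsSymmConvexBody K) {x : 𝔼} (hx : x ≠ 0) :
    0 < gauge K x :=
  (_root_.gauge_pos (absorbent_nhds_zero (mem_interior_iff_mem_nhds.1 hK.zero_mem_interior))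
    ((NormedSpace.isVonNBounded_iff ℝ).2 hK.isCompact.isBounded)).2 hx

theorem IsSymmConvexBody.smul_mem_iff {K : Set 𝔼} (hK : IsSymmConvexBody K) {x : 𝔼} (hx : x ≠ 0)
    {r : ℝ} (hr : 0 ≤ r) : r • x ∈ K ↔ r ≤ (gauge K x)⁻¹ := by
  have h := gauge_le_one_iff_mem_closure (x := r • x) hK.convex
    (mem_interior_iff_mem_nhds.1 hK.zero_mem_interior)
  rw [hK.isCompact.isClosed.closure_eq, gauge_smul_of_nonneg hr, smul_eq_mul] at h
  rw [← h, ← one_div, le_div_iff₀ (hK.gauge_pos hx)]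

theorem IsSymmConvexBody.radialFunction_eq {K : Set 𝔼} (hK : IsSymmConvexBody K) {x : 𝔼}
    (hx : x ≠ 0) : radialFunction K x = (gauge K x)⁻¹ := by
  have : {r : ℝ | 0 ≤ r ∧ r • x ∈ K} = Icc 0 (gauge K x)⁻¹ := by
    ext r
    constructor
    · exact fun h => ⟨h.1, (hK.smul_mem_iff hx h.1).1 h.2⟩
    · exact fun h => ⟨h.1, (hK.smul_mem_iff hx h.1).2 h.2⟩
  rw [radialFunction, this, csSup_Icc (inv_nonneg.2 (gauge_nonneg x))]

theorem IsSymmConvexBody.radialFunction_pos {K : Set 𝔼} (hK : IsSymmConvexBody K) {x : 𝔼}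
    (hx : x ≠ 0) : 0 < radialFunction K x := by
  rw [hK.radialFunction_eq hx]
  exact inv_pos.2 (hK.gauge_pos hx)

theorem IsSymmConvexBody.continuous_radialFunction {K : Set 𝔼} (hK : IsSymmConvexBody K) :
    Continuous fun θ : sphere (0 : 𝔼) 1 => radialFunction K θ := by
  have : (fun θ : sphere (0 : 𝔼) 1 => radialFunction K θ) =
      fun θ : sphere (0 : 𝔼) 1 => (gauge K (θ : 𝔼))⁻¹ :=
    funext fun θ => hK.radialFunction_eq (ne_zero_of_mem_unit_sphere θ)
  rw [this]
  exact ((continuous_gauge hK.convex (mem_interior_iff_mem_nhds.1 hK.zero_mem_interior)).comp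
    continuous_subtype_val).inv₀ fun θ => (hK.gauge_pos (ne_zero_of_mem_unit_sphere θ)).ne'

theorem radialFunction_closedBall {r : ℝ} (hr : 0 ≤ r) (θ : sphere (0 : 𝔼) 1) :
    radialFunction (closedBall 0 r) (θ : 𝔼) = r := by
  have : {s : ℝ | 0 ≤ s ∧ s • (θ : 𝔼) ∈ closedBall 0 r} = Icc 0 r := by
    ext s
    simp only [mem_ofPred_eq, mem_closedBall_zero_iff, norm_smul, norm_eq_of_mem_sphere, mul_one,
      mem_Icc, Real.norm_eq_abs]
    constructor
    · exact fun h => ⟨h.1, (le_abs_self s).trans h.2⟩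
    · exact fun h => ⟨h.1, by rw [abs_of_nonneg h.1]; exact h.2⟩
  rw [radialFunction, this, csSup_Icc hr]

theorem radialFunction_nonneg (L : Set 𝔼) (x : 𝔼) : 0 ≤ radialFunction L x :=
  Real.sSup_nonneg fun _ h => h.1

/-- A star body may have radial function zero in some directions; one positive direction and
continuity suffice for `IsStarBody.integral_pos`. -/
theorem IsStarBody.exists_radialFunction_pos (hn : 0 < n) {L : Set 𝔼} (hL : IsStarBody L) :
    ∃ θ : sphere (0 : 𝔼) 1, 0 < radialFunction L θ := by
  have : Nonempty (Fin n) := ⟨⟨0, hn⟩⟩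
  obtain ⟨x, hxL, hx⟩ := (dense_compl_singleton (0 : 𝔼)).inter_open_nonempty _ isOpen_interior
    hL.interior_nonempty
  have hx0 : x ≠ 0 := hx
  have hxn := norm_pos_iff.2 hx0
  refine ⟨⟨‖x‖⁻¹ • x, by simp [norm_smul, hxn.ne']⟩, hxn.trans_le (le_csSup ?_ ?_)⟩
  · obtain ⟨R, hR⟩ := hL.isCompact.isBounded.subset_closedBall 0
    refine ⟨R, fun r hr => ?_⟩
    have := hR hr.2
    rw [mem_closedBall_zero_iff, norm_smul, norm_smul, norm_inv, norm_norm,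
      inv_mul_cancel₀ hxn.ne', mul_one] at this
    exact (le_abs_self r).trans this
  · refine ⟨hxn.le, ?_⟩
    simp only [smul_smul, mul_inv_cancel₀ hxn.ne', one_smul]
    exact interior_subset hxL

theorem IsStarBody.continuous_radialFunction {L : Set 𝔼} (hL : IsStarBody L) :
    Continuous fun θ : sphere (0 : 𝔼) 1 => radialFunction L θ :=
  continuousOn_iff_continuous_domRestrict.1 hL.continuousOn_radial

theorem IsStarBody.integral_pos (hn : 0 < n) {L : Set 𝔼} (hL : IsStarBody L) (k : ℕ)
    (f : C(sphere (0 : 𝔼) 1, ℝ)) (hf : ∀ θ, 0 < f θ) :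
    0 < ∫ θ : sphere (0 : 𝔼) 1, f θ * radialFunction L θ ^ k
      ∂(volume : Measure 𝔼).toSphere := by
  obtain ⟨θ, hθ⟩ := hL.exists_radialFunction_pos hn
  refine Continuous.integral_pos_of_hasCompactSupport_nonneg_nonzero (x := θ)
    (f.continuous.mul (hL.continuous_radialFunction.pow k)) (HasCompactSupport.of_compactSpace _)
    (fun θ => mul_nonneg (hf θ).le (pow_nonneg (radialFunction_nonneg L θ) k)) ?_
  exact (mul_pos (hf θ) (pow_pos hθ k)).ne'

theorem toSphere_univ_real {F : Type*} [NormedAddCommGroup F] [InnerProductSpace ℝ F]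
    [FiniteDimensional ℝ F] [MeasurableSpace F] [BorelSpace F] [Nontrivial F] :
    ((volume : Measure F).toSphere univ).toReal =
      Module.finrank ℝ F * unitBallVolume (Module.finrank ℝ F) := by
  rw [Measure.toSphere_apply_univ, volume_unitBall, ENNReal.toReal_mul,
    ENNReal.toReal_ofReal (unitBallVolume_pos _).le, ENNReal.toReal_natCast]

theorem integral_sphereProb {F : Type*} [NormedAddCommGroup F] [InnerProductSpace ℝ F]
    [FiniteDimensional ℝ F] [MeasurableSpace F] [BorelSpace F] [Nontrivial F]
    (f : sphere (0 : F) 1 → ℝ) :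
    ∫ θ, f θ ∂sphereProb F = (Module.finrank ℝ F * unitBallVolume (Module.finrank ℝ F))⁻¹ *
      ∫ θ, f θ ∂(volume : Measure F).toSphere := by
  rw [sphereProb, integral_smul_measure, ENNReal.toReal_inv, toSphere_univ_real, smul_eq_mul]

/-- Volume of a central section in polar coordinates. -/
theorem IsSymmConvexBody.volume_section {K : Set 𝔼} (hK : IsSymmConvexBody K)
    (E : Submodule ℝ 𝔼) [Nontrivial E] :
    (volume {x : E | (x : 𝔼) ∈ K}).toReal = (Module.finrank ℝ E : ℝ)⁻¹ *
      ∫ θ : sphere (0 : E) 1, radialFunction K (sphereInclusion E θ) ^ Module.finrank ℝ E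
        ∂(volume : Measure E).toSphere := by
  have hd : 0 < Module.finrank ℝ E := Module.finrank_pos
  set d := Module.finrank ℝ E with hdd
  have hS : MeasurableSet {x : E | (x : 𝔼) ∈ K} :=
    (hK.isCompact.isClosed.preimage continuous_subtype_val).measurableSet
  have hincl : Continuous (sphereInclusion E) := by
    refine Continuous.subtype_mk ?_ _
    exact continuous_subtype_val.comp continuous_subtype_val
  have hcont : Continuous fun θ : sphere (0 : E) 1 => radialFunction K (sphereInclusion E θ) :=
    hK.continuous_radialFunction.comp hincl
  rw [← integral_const_mul, integral_eq_lintegral_of_nonneg_ae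
    (ae_of_all _ fun θ => mul_nonneg (by positivity) (pow_nonneg (radialFunction_nonneg _ _) _))
    (continuous_const.mul (hcont.pow d)).aestronglyMeasurable,
    ← lintegral_indicator_one hS, lintegral_eq_lintegral_sphere volume (measurable_one.indicator hS)]
  congr 1
  refine lintegral_congr fun θ => ?_
  have hθ : ((sphereInclusion E θ : sphere (0 : 𝔼) 1) : 𝔼) ≠ 0 := ne_zero_of_mem_unit_sphere _
  set ρ := radialFunction K (sphereInclusion E θ) with hρ
  have hmem : ∀ r : ℝ, 0 < r → (r • (θ : E) ∈ {x : E | (x : 𝔼) ∈ K} ↔ r ≤ ρ) := fun r hr => by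
    rw [hρ, hK.radialFunction_eq hθ, ← hK.smul_mem_iff hθ hr.le]
    rfl
  calc _ = ∫⁻ r in Ioc (0 : ℝ) ρ, ENNReal.ofReal (1 * r ^ (d - 1)) := by
        rw [← lintegral_indicator measurableSet_Ioi, ← lintegral_indicator measurableSet_Ioc]
        refine lintegral_congr fun r => ?_
        by_cases hr : 0 < r
        · rw [indicator_of_mem (mem_Ioi.2 hr)]
          by_cases hrρ : r ≤ ρ
          · rw [indicator_of_mem ((hmem r hr).2 hrρ),
              indicator_of_mem (s := Ioc 0 ρ) ⟨hr, hrρ⟩]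
            simp [hdd]
          · rw [indicator_of_notMem (fun h => hrρ ((hmem r hr).1 h)),
              indicator_of_notMem (s := Ioc 0 ρ) (fun h => hrρ h.2), mul_zero]
        · rw [indicator_of_notMem (s := Ioi 0) (fun h => hr h),
            indicator_of_notMem (s := Ioc 0 ρ) (fun h => hr h.1)]
    _ = _ := by
        rw [IsEvenLogConcave.lintegral_const_mul_pow zero_le_one (radialFunction_nonneg _ _),
          Nat.sub_add_cancel hd, Nat.cast_pred hd]
        congr 1
        ring

/-- The power `ρ_K ^ m` of the radial function of a convex body as a continuous function. -/
noncomputable def radialPow (K : Set 𝔼) (hK : IsSymmConvexBody K) (m : ℕ) :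
    C(sphere (0 : 𝔼) 1, ℝ) :=
  ⟨fun θ => radialFunction K θ ^ m, hK.continuous_radialFunction.pow m⟩

theorem sphericalRadon_radialPow {K : Set 𝔼} (hK : IsSymmConvexBody K) {m : ℕ} (hm : 0 < m)
    (E : RealGrassmannian n m) :
    sphericalRadon (radialPow K hK m) E =
      (volume {x : E.1 | (x : 𝔼) ∈ K}).toReal / unitBallVolume m := by
  have hE : Module.finrank ℝ E.1 = m := E.2
  have : Nontrivial E.1 := Module.nontrivial_of_finrank_pos (R := ℝ) (by rw [hE]; exact hm)
  have hm' : (0 : ℝ) < m := by positivity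
  rw [sphericalRadon, integral_sphereProb, hK.volume_section, hE]
  have := unitBallVolume_pos m
  simp only [radialPow, ContinuousMap.coe_mk]
  field_simp

theorem sphericalRadon_const {m : ℕ} (hm : 0 < m) (c : ℝ) (E : RealGrassmannian n m) :
    sphericalRadon (ContinuousMap.const _ c) E = c := by
  have hE : Module.finrank ℝ E.1 = m := E.2
  have : Nontrivial E.1 := Module.nontrivial_of_finrank_pos (R := ℝ) (by rw [hE]; exact hm)
  have hm' : (0 : ℝ) < m := by positivity
  have hω := unitBallVolume_pos m
  rw [sphericalRadon, integral_sphereProb, hE]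
  simp only [ContinuousMap.const_apply, integral_const, smul_eq_mul, measureReal_def,
    toSphere_univ_real, hE]
  field_simp

/-! ### Two-sided bounds for central sections of an isotropic body. -/

theorem exists_isometry_orthogonal {k : ℕ} (hkn : k ≤ n) (E : RealGrassmannian n (n - k)) :
    Nonempty (EuclideanSpace ℝ (Fin k) ≃ₗᵢ[ℝ] E.1ᗮ) := by
  have h1 := E.1.finrank_add_finrank_orthogonal
  have hE : Module.finrank ℝ E.1 = n - k := E.2
  rw [hE, finrank_euclideanSpace_fin] at h1
  have h2 : Module.finrank ℝ E.1ᗮ = k := by omega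
  exact ⟨((stdOrthonormalBasis ℝ E.1ᗮ).reindex (finCongr h2)).repr.symm⟩

theorem maxIsotropicConstant_nonneg (k : ℕ) : 0 ≤ maxIsotropicConstant k := by
  refine Real.sSup_nonneg ?_
  rintro _ ⟨K, _, rfl⟩
  exact Real.sSup_nonneg fun c hc => hc.1

/-- Central sections of an isotropic body, compared with those of the ball of equal volume. -/
theorem section_bounds {m k : ℕ} (hm : 0 < m) (hk : 0 < k) {ω₁ ω₂ ω₃ r V A g L M : ℝ}
    (hω₁ : ω₁ = unitBallVolume m) (hω₂ : ω₂ = unitBallVolume (m + k))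
    (hω₃ : ω₃ = unitBallVolume k) (hr : 0 < r) (hV : V = r ^ (m + k) * ω₂) (hA : 0 < A)
    (hg : 0 < g) (hM : 0 ≤ M) (hL : L = √(A / V ^ (1 + 2 / (m + k : ℕ) : ℝ)))
    (hlow : V ≤ 2 * ω₃ * g * √(2 * k * A / V) ^ k)
    (hup : A * g ^ (2 / k : ℝ) ≤ 54 ^ 3 * V ^ (1 + 2 / k : ℝ) * M ^ 2) :
    (√6 * 2 * √24 * √2)⁻¹ ^ k * r ^ m ≤ L ^ k * (g / ω₁) ∧
      L ^ k * (g / ω₁) ≤ (√(54 ^ 3) * M) ^ k * r ^ m := by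
  have hω₁0 : 0 < ω₁ := hω₁ ▸ unitBallVolume_pos m
  have hω₂0 : 0 < ω₂ := hω₂ ▸ unitBallVolume_pos _
  have hω₃0 : 0 < ω₃ := hω₃ ▸ unitBallVolume_pos k
  have hV0 : 0 < V := by rw [hV]; positivity
  have hk' : (0 : ℝ) < k := by positivity
  have hm' : (0 : ℝ) < m := by positivity
  set N : ℝ := ((m + k : ℕ) : ℝ) with hN
  have hNe : N = m + k := by rw [hN]; push_cast; ring
  have hN0 : 0 < N := by rw [hNe]; positivity
  have hL0 : 0 < L := by rw [hL]; positivity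
  have hA2 : A = L ^ 2 * V ^ (1 + 2 / N : ℝ) := by
    rw [hL, Real.sq_sqrt (by positivity)]
    field_simp
  have hVm : V ^ (m / N : ℝ) = r ^ m * ω₂ ^ (m / N : ℝ) := by
    rw [hV, Real.mul_rpow (by positivity) hω₂0.le, ← Real.rpow_natCast, ← Real.rpow_mul hr.le,
      ← Real.rpow_natCast]
    congr 2
    field_simp
    exact hN.symm ▸ rfl
  have hVk : V ^ (m / N : ℝ) * V ^ (k / N : ℝ) = V := by
    rw [← Real.rpow_add hV0, ← add_div, ← hNe, div_self hN0.ne', Real.rpow_one]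
  have h1 : ω₂ ^ (m / N : ℝ) ≤ ω₁ := by
    rw [hω₁, hω₂]
    exact rpow_unitBallVolume_le hm (Nat.le_add_right m k)
  have h2 : ω₁ ≤ √6 ^ k * ω₂ ^ (m / N : ℝ) := by
    rw [hω₁, hω₂]
    exact unitBallVolume_le_rpow hm
  have h3 : ω₃ * √(k : ℝ) ^ k ≤ √24 ^ k := hω₃ ▸ unitBallVolume_mul_sqrt_pow_le hk
  constructor
  -- Lower bound: the Chebyshev radius is rewritten through `L`, and a factor `V ^ (k / N)` is
  -- cancelled to leave `V ^ (m / N)`, a multiple of `r ^ m`.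
  · have e1 : √(2 * k * A / V) = √2 * √k * L * V ^ (1 / N : ℝ) := by
      rw [Real.sqrt_eq_iff_mul_self_eq_of_pos (by positivity), hA2, Real.rpow_add hV0, Real.rpow_one]
      have e2 : (V ^ (1 / N : ℝ)) ^ 2 = V ^ (2 / N : ℝ) := by
        rw [← Real.rpow_natCast, ← Real.rpow_mul hV0.le]
        congr 1
        push_cast
        ring
      rw [← sq, mul_pow, mul_pow, mul_pow, Real.sq_sqrt (by norm_num), Real.sq_sqrt hk'.le, e2]
      field_simp
    have e3 : (V ^ (1 / N : ℝ)) ^ k = V ^ (k / N : ℝ) := by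
      rw [← Real.rpow_natCast, ← Real.rpow_mul hV0.le]
      congr 1
      ring
    rw [e1, mul_pow, e3] at hlow
    have h4 : V ^ (m / N : ℝ) ≤ 2 * ω₃ * g * (√2 * √k * L) ^ k := by
      have hVk0 : 0 < V ^ (k / N : ℝ) := by positivity
      refine le_of_mul_le_mul_right ?_ hVk0
      rw [hVk]
      linarith
    have h5 : ω₁ * r ^ m ≤ (√6 * 2 * √24 * √2) ^ k * (L ^ k * g) :=
      calc ω₁ * r ^ m ≤ √6 ^ k * ω₂ ^ (m / N : ℝ) * r ^ m := by gcongr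
        _ = √6 ^ k * V ^ (m / N : ℝ) := by rw [hVm]; ring
        _ ≤ √6 ^ k * (2 * ω₃ * g * (√2 * √k * L) ^ k) := by gcongr
        _ = √6 ^ k * 2 * (ω₃ * √(k : ℝ) ^ k) * √2 ^ k * (L ^ k * g) := by
          rw [mul_pow, mul_pow]; ring
        -- The Chebyshev factor 2 is absorbed as `2 ≤ 2 ^ k`, so that every constant is a `k`-th
        -- power.
        _ ≤ √6 ^ k * 2 ^ k * (√24 ^ k) * √2 ^ k * (L ^ k * g) := by
          gcongr
          exact le_self_pow₀ one_le_two hk.ne'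
        _ = _ := by rw [mul_pow, mul_pow, mul_pow]
    rw [inv_pow, inv_mul_le_iff₀ (by positivity), mul_div_assoc', mul_div_assoc', le_div_iff₀ hω₁0]
    linarith
  -- Upper bound: the hypothesis is raised to the power `k / 2`, and `(2 / k - 2 / N) * (k / 2) = m
  -- / N`.
  · have h4 : L ^ 2 * g ^ (2 / k : ℝ) ≤ 54 ^ 3 * M ^ 2 * V ^ (2 / k - 2 / N : ℝ) := by
      rw [hA2, Real.rpow_add hV0, Real.rpow_add hV0, Real.rpow_one] at hup
      rw [Real.rpow_sub hV0, mul_div_assoc', le_div_iff₀ (by positivity)]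
      refine le_of_mul_le_mul_right ?_ hV0
      linarith
    have h5 := Real.rpow_le_rpow (by positivity) h4 (by positivity : (0 : ℝ) ≤ k / 2)
    have e1 : (L ^ 2 * g ^ (2 / k : ℝ)) ^ (k / 2 : ℝ) = L ^ k * g := by
      rw [Real.mul_rpow (by positivity) (by positivity), ← Real.rpow_natCast, ← Real.rpow_natCast,
        ← Real.rpow_mul hL0.le, ← Real.rpow_mul hg.le]
      congr 1
      · congr 1
        push_cast
        ring
      · rw [show (2 / k : ℝ) * (k / 2) = 1 by field_simp, Real.rpow_one]
    have e2 : (54 ^ 3 * M ^ 2 * V ^ (2 / k - 2 / N : ℝ)) ^ (k / 2 : ℝ) =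
        (√(54 ^ 3) * M) ^ k * V ^ (m / N : ℝ) := by
      rw [Real.mul_rpow (by positivity) (by positivity), ← Real.rpow_mul hV0.le]
      congr 1
      · have : (54 ^ 3 * M ^ 2 : ℝ) = (√(54 ^ 3) * M) ^ (2 : ℝ) := by
          rw [Real.rpow_two, mul_pow, Real.sq_sqrt (by norm_num)]
        rw [this, ← Real.rpow_mul (by positivity), ← Real.rpow_natCast _ k]
        congr 1
        ring
      · rw [show (m : ℝ) = N - k by rw [hNe]; ring]
        congr 1
        field_simp
    rw [e1, e2, hVm] at h5
    rw [mul_div_assoc', div_le_iff₀ hω₁0]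
    calc _ ≤ _ := h5
      _ ≤ (√(54 ^ 3) * M) ^ k * (r ^ m * ω₁) := by gcongr
      _ = _ := by ring

theorem sphericalRadon_bounds {k : ℕ} (hk : 0 < k) (hkn : k < n) {K : Set 𝔼}
    (hK : IsSymmConvexBody K) (hiso : IsInIsotropicPosition K) {r : ℝ} (hr : 0 < r)
    (hvol : volume (closedBall (0 : 𝔼) r) = volume K) (E : RealGrassmannian n (n - k)) :
    (√6 * 2 * √24 * √2)⁻¹ ^ k * r ^ (n - k) ≤
        isotropicConstant K ^ k * sphericalRadon (radialPow K hK (n - k)) E ∧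
      isotropicConstant K ^ k * sphericalRadon (radialPow K hK (n - k)) E ≤
        (√(54 ^ 3) * maxIsotropicConstant k) ^ k * r ^ (n - k) := by
  have hn : 0 < n := by omega
  have hm : 0 < n - k := by omega
  have : Nonempty (Fin n) := ⟨⟨0, hn⟩⟩
  obtain ⟨A, hA⟩ := hiso
  obtain ⟨θ₀, hθ₀⟩ : ∃ θ : 𝔼, ‖θ‖ = 1 := exists_norm_eq _ zero_le_one
  have hA0 : 0 < A := hA θ₀ hθ₀ ▸ hK.integral_pos hθ₀
  obtain ⟨φ⟩ := exists_isometry_orthogonal hkn.le E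
  have hg := isEvenLogConcave_sectionVolume (E := E.1) (φ := φ) hK
  have hV0 := hK.volume_real_pos
  have hgV : ∫⁻ y, ENNReal.ofReal (sectionVolume E.1 φ K y) =
      ENNReal.ofReal (volume K).toReal := by
    rw [lintegral_sectionVolume_eq hK.isCompact, ENNReal.ofReal_toReal hK.measure_ne_top]
  have hgA := fun θ hθ => lintegral_sectionVolume_inner_sq (E := E.1) (φ := φ) hK.isCompact hA
    (θ := θ) hθ
  have hg0 : sectionVolume E.1 φ K 0 = (volume {x : E.1 | (x : 𝔼) ∈ K}).toReal := by
    simp [sectionVolume]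
  have hV : (volume K).toReal = r ^ (n - k + k) * unitBallVolume (n - k + k) := by
    rw [← hvol, Measure.addHaar_closedBall volume _ hr.le, volume_unitBall,
      finrank_euclideanSpace_fin, ENNReal.toReal_mul, ENNReal.toReal_ofReal (by positivity),
      ENNReal.toReal_ofReal (unitBallVolume_pos n).le, Nat.sub_add_cancel hkn.le]
  rw [sphericalRadon_radialPow hK hm, ← hg0]
  refine section_bounds hm hk rfl rfl rfl hr hV hA0 hg.zero_pos (maxIsotropicConstant_nonneg k) ?_
    (hg.volume_le hk hV0 hA0 hgV hgA) (hg.le_maxIsotropicConstant hk hV0 hA0 hgV hgA)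
  rw [Nat.sub_add_cancel hkn.le]
  exact isotropicConstant_eq hn hK hA

end

/-! ### From sections to dual mixed volumes. -/

/-- The ratio of dual mixed volumes as a ratio of integrals over the Grassmannian. -/
theorem IsBusemannPettyBody.dualMixedVolume_div {n k : ℕ} (hk : 0 < k) (hkn : k < n)
    {K L : Set (EuclideanSpace ℝ (Fin n))} (hK : IsSymmConvexBody K) (hL : IsBusemannPettyBody k L)
    {r : ℝ} (hr : 0 < r) :
    ∃ μ : Measure (RealGrassmannian n (n - k)), IsFiniteMeasure μ ∧
      Integrable (sphericalRadon (radialPow K hK (n - k))) μ ∧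
      0 < r ^ (n - k) * μ.real univ ∧ 0 < ∫ E, sphericalRadon (radialPow K hK (n - k)) E ∂μ ∧
      dualMixedVolume (k : ℝ) L (closedBall 0 r) / dualMixedVolume (k : ℝ) L K =
        r ^ (n - k) * μ.real univ / ∫ E, sphericalRadon (radialPow K hK (n - k)) E ∂μ := by
  have hn : 0 < n := by omega
  have hm : 0 < n - k := by omega
  have hn' : (0 : ℝ) < n := by positivity
  have : Nonempty (Fin n) := ⟨⟨0, hn⟩⟩
  obtain ⟨hLs, μ, hμ, h⟩ := hL
  have hω := unitBallVolume_pos n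
  set c : ℝ := n * unitBallVolume n with hc
  have hc0 : 0 < c := by positivity
  have hI : ∀ f : C(sphere (0 : EuclideanSpace ℝ (Fin n)) 1, ℝ),
      ∫ E, sphericalRadon f E ∂μ = c⁻¹ * ∫ θ : sphere (0 : EuclideanSpace ℝ (Fin n)) 1,
        f θ * radialFunction L θ ^ k ∂(volume : Measure _).toSphere := by
    intro f
    rw [← h f, integral_sphereProb, finrank_euclideanSpace_fin]
  have hpos : ∀ f : C(sphere (0 : EuclideanSpace ℝ (Fin n)) 1, ℝ), (∀ θ, 0 < f θ) →
      0 < ∫ E, sphericalRadon f E ∂μ := fun f hf => by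
    rw [hI]
    exact mul_pos (inv_pos.2 hc0) (hLs.integral_pos hn k f hf)
  have hVol : ∀ (M : Set (EuclideanSpace ℝ (Fin n)))
      (f : C(sphere (0 : EuclideanSpace ℝ (Fin n)) 1, ℝ)),
      (∀ θ : sphere (0 : EuclideanSpace ℝ (Fin n)) 1, f θ = radialFunction M θ ^ (n - k)) →
      dualMixedVolume (k : ℝ) L M = (c / n) * ∫ E, sphericalRadon f E ∂μ := by
    intro M f hf
    have e : ∀ θ : sphere (0 : EuclideanSpace ℝ (Fin n)) 1,
        radialFunction L θ ^ (k : ℝ) * radialFunction M θ ^ ((n : ℝ) - k) =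
          f θ * radialFunction L θ ^ k := fun θ => by
      rw [hf, ← Nat.cast_sub hkn.le, Real.rpow_natCast, Real.rpow_natCast, mul_comm]
    rw [hI, dualMixedVolume]
    simp only [e]
    field_simp
  have hconst := hpos (ContinuousMap.const _ (r ^ (n - k))) fun _ => by
    simp only [ContinuousMap.const_apply]; positivity
  have hD := hVol (closedBall 0 r) (ContinuousMap.const _ (r ^ (n - k))) fun θ => by
    rw [radialFunction_closedBall hr.le, ContinuousMap.const_apply]
  have hKr := hpos (radialPow K hK (n - k)) fun θ =>
    pow_pos (hK.radialFunction_pos (ne_zero_of_mem_unit_sphere θ)) _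
  have hKV := hVol K (radialPow K hK (n - k)) fun θ => rfl
  simp only [sphericalRadon_const hm, integral_const, smul_eq_mul] at hconst hD
  rw [mul_comm] at hconst
  -- The Radon transform is integrable because its Bochner integral is non-zero; no separate
  -- measurability argument on the Grassmannian is required.
  refine ⟨μ, hμ, Integrable.of_integral_ne_zero hKr.ne', hconst, hKr, ?_⟩
  rw [hD, hKV, mul_div_mul_left _ _ (by positivity), mul_comm]

theorem mainTheorem7 :
    ∃ C₁ C₂ : ℝ, 0 < C₁ ∧ 0 < C₂ ∧
      ∀ (n k : ℕ), 1 ≤ k → k < n →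
      ∀ K : Set (EuclideanSpace ℝ (Fin n)), IsSymmConvexBody K → IsInIsotropicPosition K →
      ∀ D : Set (EuclideanSpace ℝ (Fin n)), (∃ r : ℝ, 0 < r ∧ D = closedBall 0 r) →
        volume D = volume K →
      ∀ L : Set (EuclideanSpace ℝ (Fin n)), IsBusemannPettyBody k L →
        C₁ ≤ isotropicConstant K /
            (dualMixedVolume (k : ℝ) L D / dualMixedVolume (k : ℝ) L K) ^ (1 / (k : ℝ)) ∧
        isotropicConstant K /
            (dualMixedVolume (k : ℝ) L D / dualMixedVolume (k : ℝ) L K) ^ (1 / (k : ℝ)) ≤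
          C₂ * maxIsotropicConstant k := by
  -- In `C₁`, `√6` and `√24` come from ball volumes, `2` and `√2` from Chebyshev. In `C₂`, `54 ^ 3`
  -- comes from Ball's set.
  refine ⟨(√6 * 2 * √24 * √2)⁻¹, √(54 ^ 3), by positivity, by positivity, ?_⟩
  rintro n k hk hkn K hK hiso _ ⟨r, hr, rfl⟩ hvol L hL
  obtain ⟨μ, hμ, hint, hμ0, hI0, hX⟩ := hL.dualMixedVolume_div hk hkn hK hr
  have hb := sphericalRadon_bounds hk hkn hK hiso hr hvol
  rw [hX]
  set I := ∫ E, sphericalRadon (radialPow K hK (n - k)) E ∂μ with hI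
  set c : ℝ := (√6 * 2 * √24 * √2)⁻¹ with hc
  set Λ := isotropicConstant K with hΛ
  set C := √(54 ^ 3) * maxIsotropicConstant k with hC
  have hc0 : 0 < c := by positivity
  have hΛ0 : 0 ≤ Λ := Real.sSup_nonneg fun _ h => h.1
  have hC0 : 0 ≤ C := mul_nonneg (Real.sqrt_nonneg _) (maxIsotropicConstant_nonneg k)
  -- The bounds for single subspaces are integrated against the finite measure `μ`.
  have hlow : c ^ k * (r ^ (n - k) * μ.real univ) ≤ Λ ^ k * I := by
    have := integral_mono (integrable_const _) (hint.const_mul (Λ ^ k)) fun E => (hb E).1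
    rw [integral_const, integral_const_mul, smul_eq_mul] at this
    linarith
  have hup : Λ ^ k * I ≤ C ^ k * (r ^ (n - k) * μ.real univ) := by
    have := integral_mono (hint.const_mul (Λ ^ k)) (integrable_const _) fun E => (hb E).2
    rw [integral_const, integral_const_mul, smul_eq_mul] at this
    linarith
  set X := r ^ (n - k) * μ.real univ / I with hXd
  have hX0 : 0 < X := by positivity
  have hroot : (X ^ (1 / (k : ℝ))) ^ k = X := by
    rw [one_div]
    exact Real.rpow_inv_natCast_pow hX0.le (by omega)
  have hk0 : k ≠ 0 := by omega
  have hR0 : 0 < X ^ (1 / (k : ℝ)) := by positivity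
  constructor
  · rw [le_div_iff₀ hR0, ← pow_le_pow_iff_left₀ (by positivity) hΛ0 hk0, mul_pow, hroot, hXd,
      mul_div_assoc', div_le_iff₀ hI0]
    exact hlow
  · rw [div_le_iff₀ hR0, ← pow_le_pow_iff_left₀ hΛ0 (by positivity) hk0, mul_pow, hroot, hXd,
      mul_div_assoc', le_div_iff₀ hI0]
    exact hup
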